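/- A state is a positive semidefinite $4\times4$ complex matrix of trace one, regarded as a state of two qubits on $\mathbb{C}^2\otimes\mathbb{C}^2$. It is separable if it is a convex combination of product states $\alpha\otimes\beta$, and absolutely separable if $U\rho U^\dagger$ is separable for every unitary $U$ on $\mathbb{C}^2\otimes\mathbb{C}^2$. For a Hermitian observable $A$ and a set $X$ of states let $L_X(A)=\{\operatorname{Tr}(\rho A):\rho\in X\}\subset\mathbb{R}$, with length $\operatorname{vol}L_X(A)$; write $L$, $L_{\mathrm{SEP}}$, $L_{\mathrm{ABS}}$ when $X$ is the set of all, of all separable, and of all absolutely separable states. Let $$\mu_{2,1}=\inf_{A}\frac{\operatorname{vol}L_{\mathrm{SEP}}(A)}{\operatorname{vol}L(A)},$$ the infimum being over all Hermitian $A$ that are not multiples of the identity. Then: 1. $\mu_{2,1}\ge\sqrt2-1$. 2. For every Hermitian $A$ there are absolutely separable states $\rho,\sigma$ with $\operatorname{Tr}(\rho A)-\operatorname{Tr}(\sigma A)\ge(\sqrt2-1)\operatorname{vol}L(A)$. 3. $\sqrt2-1$ is the best bound obtainable from absolutely separable states: over all Hermitian $A$ that are not multiples of the identity, $$\min_{A}\frac{\operatorname{vol}L_{\mathrm{ABS}}(A)}{\operatorname{vol}L(A)}=\sqrt2-1,$$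 and every Hermitian $A$ with spectrum $(1,\tfrac12,\tfrac12,0)$ attains this minimum. -/

import Mathlib

open MeasureTheory
open scoped ComplexOrder Kronecker Matrix

noncomputable section

/-- The quantum states (density matrices) on the finite-dimensional Hilbert space with orthonormal
basis indexed by `ι`: positive semidefinite complex matrices of trace one. -/
def quantumStates (ι : Type) [Fintype ι] : Set (Matrix ι ι ℂ) :=
  {ρ | ρ.PosSemidef ∧ ρ.trace = 1}

/-- Separable states of two `d`-level systems: convex combinations of product states. -/
def separableStates (d : ℕ) : Set (Matrix (Fin d × Fin d) (Fin d × Fin d) ℂ) :=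
  convexHull ℝ {ρ | ∃ α ∈ quantumStates (Fin d), ∃ β ∈ quantumStates (Fin d), ρ = α ⊗ₖ β}

/-- Absolutely separable states of two `d`-level systems: states that stay separable under every
global unitary. -/
def absSeparableStates (d : ℕ) : Set (Matrix (Fin d × Fin d) (Fin d × Fin d) ℂ) :=
  {ρ | ρ ∈ quantumStates (Fin d × Fin d) ∧
    ∀ U ∈ Matrix.unitaryGroup (Fin d × Fin d) ℂ, U * ρ * Uᴴ ∈ separableStates d}

/-- The expectation value `Tr (ρ A)`. It is real for a state `ρ` and a Hermitian `A`. -/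
def expectation {ι : Type} [Fintype ι] (A ρ : Matrix ι ι ℂ) : ℝ := (ρ * A).trace.re

/-- The joint numerical range of `A₁, …, A_k` restricted to the set `X` of states. -/
def numericalRange {ι : Type} [Fintype ι] {k : ℕ} (X : Set (Matrix ι ι ℂ))
    (A : Fin k → Matrix ι ι ℂ) : Set (Fin k → ℝ) :=
  (fun ρ j => expectation (A j) ρ) '' X

/-- The volume in `ℝᵏ` of the joint numerical range restricted to `X`. -/
def volRange {ι : Type} [Fintype ι] {k : ℕ} (X : Set (Matrix ι ι ℂ))
    (A : Fin k → Matrix ι ι ℂ) : ℝ :=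
  (volume (numericalRange X A)).toReal

/-- The volume of the numerical range restricted to `X`, relative to that of the (unrestricted)
numerical range. -/
def volRatio {ι : Type} [Fintype ι] {k : ℕ} (X : Set (Matrix ι ι ℂ))
    (A : Fin k → Matrix ι ι ℂ) : ℝ :=
  volRange X A / volRange (quantumStates ι) A

/-- `k` independent measurements: Hermitian observables whose traceless parts are linearly
independent over `ℝ`. For `k = 1` this says that the observable is Hermitian and not a multiple of
the identity. -/
def IndependentObservables {ι : Type} [Fintype ι] [DecidableEq ι] {k : ℕ}
    (A : Fin k → Matrix ι ι ℂ) : Prop :=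
  (∀ j, (A j).IsHermitian) ∧
    LinearIndependent ℝ
      (fun j => A j - ((A j).trace / (Fintype.card ι : ℂ)) • (1 : Matrix ι ι ℂ))

/-- The relative volumes reached by `k` independent measurements on two `d`-level systems, for the
numerical range restricted to `X`. -/
def volRatios {d : ℕ} (k : ℕ) (X : Set (Matrix (Fin d × Fin d) (Fin d × Fin d) ℂ)) : Set ℝ :=
  {r | ∃ A : Fin k → Matrix (Fin d × Fin d) (Fin d × Fin d) ℂ,
    IndependentObservables A ∧ r = volRatio X A}

/-- The minimal volume ratio `μ_{d,k}` of the separable numerical range compared to the numerical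
range, for `k` independent measurements on two `d`-level systems. -/
def minVolRatio (d k : ℕ) : ℝ := sInf (volRatios k (separableStates d))

end

/-! Put t = (√2 - 1)/2. The lower bounds rest on one fact: 1/4 + t(|ψ⟩⟨ψ| - |φ⟩⟨φ|) is separable for
all unit vectors ψ, φ (`tiltedState_mem_separableStates`). Unitaries permute these states, so they
are absolutely separable. With ψ, φ eigenvectors of A for its extreme eigenvalues, exchanging ψ and
φ changes the expectation by 2t = √2 - 1 times the length of the full range.

For separability, Takagi factorization diagonalizes the state ρ as F diag(σ) F†, with the columns of
F orthonormal for the spin flip form, whose null vectors are the product vectors. Two such columns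
x, y give product vectors x ± iy, so ρ is separable once each σ_k is at most the sum of the others.
The signed sum of σ is Tr(Yρ) for a Hermitian Y (`lorentzForm`) with determinant -1, nonnegative
trace, and inverse similar to its transpose. Hence Y has spectrum -1, 1, s, 1/s, so that -1 ≤ Y ≤
(√2 + 1)/2 · Tr Y - 1, and t is exactly the weight for which these bounds give Tr(Yρ) ≥ 0.

Optimality comes from partial transpose witnesses: rotating two basis vectors into Bell vectors
bounds the difference of any two diagonal entries of an absolutely separable state by √2 - 1
(`apply_sub_apply_le`). For spectrum (1, 1/2, 1/2, 0) half of such a difference is the whole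
deviation of the expectation from 1/2. -/

/-! ### Convexity and unitary invariance of the sets of states -/

theorem posSemidef_vecMulVec_star {ι : Type} [Fintype ι] (x : ι → ℂ) :
    (Matrix.vecMulVec x (star x)).PosSemidef :=
  Matrix.posSemidef_vecMulVec_self_star x

theorem convex_separableStates (d : ℕ) : Convex ℝ (separableStates d) := convex_convexHull ℝ _

theorem convex_quantumStates (ι : Type) [Fintype ι] : Convex ℝ (quantumStates ι) := by
  rintro x ⟨hx, hx'⟩ y ⟨hy, hy'⟩ a b ha hb hab
  refine ⟨(hx.smul ha).add (hy.smul hb), ?_⟩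
  rw [Matrix.trace_add, Matrix.trace_smul, Matrix.trace_smul, hx', hy']
  simp only [Complex.real_smul, mul_one]
  exact_mod_cast hab

theorem separableStates_subset_quantumStates (d : ℕ) :
    separableStates d ⊆ quantumStates (Fin d × Fin d) := by
  refine convexHull_min ?_ (convex_quantumStates _)
  rintro _ ⟨α, hα, β, hβ, rfl⟩
  refine ⟨hα.1.kronecker hβ.1, ?_⟩
  rw [Matrix.trace_kronecker, hα.2, hβ.2, one_mul]

theorem absSeparableStates_subset_separableStates (d : ℕ) :
    absSeparableStates d ⊆ separableStates d := by
  intro ρ hρ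
  simpa using hρ.2 1 (one_mem _)

theorem convex_absSeparableStates (d : ℕ) : Convex ℝ (absSeparableStates d) := by
  rintro x ⟨hx, hx'⟩ y ⟨hy, hy'⟩ a b ha hb hab
  refine ⟨convex_quantumStates _ hx hy ha hb hab, fun U hU => ?_⟩
  have := convex_separableStates d (hx' U hU) (hy' U hU) ha hb hab
  simpa [mul_add, add_mul] using this

theorem conj_mem_absSeparableStates {d : ℕ} {ρ : Matrix (Fin d × Fin d) (Fin d × Fin d) ℂ}
    (hρ : ρ ∈ absSeparableStates d) {V : Matrix (Fin d × Fin d) (Fin d × Fin d) ℂ}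
    (hV : V ∈ Matrix.unitaryGroup (Fin d × Fin d) ℂ) : V * ρ * Vᴴ ∈ absSeparableStates d := by
  refine ⟨separableStates_subset_quantumStates d (hρ.2 V hV), fun U hU => ?_⟩
  have := hρ.2 (U * V) (mul_mem hU hV)
  simpa [Matrix.conjTranspose_mul, mul_assoc] using this

/-- The normalized projection onto a nonzero vector is a state. -/
theorem exists_smul_quantumState {ι : Type} [Fintype ι] {a : ι → ℂ} (ha : a ≠ 0) :
    ∃ c : ℝ, 0 ≤ c ∧ ∃ α ∈ quantumStates ι, Matrix.vecMulVec a (star a) = c • α := by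
  have hpos : 0 < (star a ⬝ᵥ a) := Matrix.dotProduct_star_self_pos_iff.2 ha
  obtain ⟨c, hc⟩ : ∃ c : ℝ, (c : ℂ) = star a ⬝ᵥ a :=
    ⟨(star a ⬝ᵥ a).re, (Complex.eq_re_of_ofReal_le hpos.le).symm⟩
  have hc0 : 0 < c := by rw [← hc] at hpos; exact_mod_cast hpos
  refine ⟨c, hc0.le, c⁻¹ • Matrix.vecMulVec a (star a),
    ⟨(posSemidef_vecMulVec_star a).smul (inv_nonneg.2 hc0.le), ?_⟩, ?_⟩
  · rw [Matrix.trace_smul, Matrix.trace_vecMulVec, dotProduct_comm, ← hc, Complex.real_smul]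
    rw [← Complex.ofReal_mul, inv_mul_cancel₀ hc0.ne', Complex.ofReal_one]
  · rw [smul_smul, mul_inv_cancel₀ hc0.ne', one_smul]

/-! ### The separable cone and product vectors -/

/-- Unnormalized separable states. -/
def separableCone (d : ℕ) : Set (Matrix (Fin d × Fin d) (Fin d × Fin d) ℂ) :=
  {M | ∃ c : ℝ, 0 ≤ c ∧ ∃ σ ∈ separableStates d, M = c • σ}

theorem add_mem_separableCone {d : ℕ} {M N : Matrix (Fin d × Fin d) (Fin d × Fin d) ℂ}
    (hM : M ∈ separableCone d) (hN : N ∈ separableCone d) : M + N ∈ separableCone d := by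
  obtain ⟨a, ha, σ, hσ, rfl⟩ := hM
  obtain ⟨b, hb, τ, hτ, rfl⟩ := hN
  rcases (add_nonneg ha hb).eq_or_lt with h | h
  · obtain ⟨rfl, rfl⟩ : a = 0 ∧ b = 0 := ⟨by linarith, by linarith⟩
    exact ⟨0, le_rfl, σ, hσ, by simp⟩
  · refine ⟨a + b, h.le, (a / (a + b)) • σ + (b / (a + b)) • τ,
      convex_separableStates d hσ hτ (by positivity) (by positivity) (by field_simp), ?_⟩
    rw [smul_add, smul_smul, smul_smul, mul_div_cancel₀ _ h.ne', mul_div_cancel₀ _ h.ne']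

theorem smul_mem_separableCone {d : ℕ} {M : Matrix (Fin d × Fin d) (Fin d × Fin d) ℂ}
    (hM : M ∈ separableCone d) {c : ℝ} (hc : 0 ≤ c) : c • M ∈ separableCone d := by
  obtain ⟨a, ha, σ, hσ, rfl⟩ := hM
  exact ⟨c * a, mul_nonneg hc ha, σ, hσ, smul_smul _ _ _⟩

theorem mem_separableStates_of_mem_separableCone {d : ℕ}
    {M : Matrix (Fin d × Fin d) (Fin d × Fin d) ℂ} (hM : M ∈ separableCone d)
    (htr : M.trace = 1) : M ∈ separableStates d := by
  obtain ⟨a, ha, σ, hσ, rfl⟩ := hM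
  rw [Matrix.trace_smul, (separableStates_subset_quantumStates d hσ).2, Complex.real_smul,
    mul_one] at htr
  obtain rfl : a = 1 := by exact_mod_cast htr
  simpa using hσ

theorem separableStates_two_nonempty : (separableStates 2).Nonempty := by
  obtain ⟨_, _, α, hα, _⟩ := exists_smul_quantumState (a := fun _ : Fin 2 => (1 : ℂ))
    (fun h => one_ne_zero (congrFun h 0))
  exact ⟨α ⊗ₖ α, subset_convexHull ℝ _ ⟨α, hα, α, hα, rfl⟩⟩

/-- The coordinates of x form a 2×2 matrix of vanishing determinant, hence of rank at most one. -/
theorem exists_eq_mul_of_null {x : Fin 2 × Fin 2 → ℂ}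
    (hx : x (0, 0) * x (1, 1) = x (0, 1) * x (1, 0)) :
    ∃ a b : Fin 2 → ℂ, ∀ p, x p = a p.1 * b p.2 := by
  by_cases h0 : x (0, 0) = 0
  · rw [h0, zero_mul, eq_comm, mul_eq_zero] at hx
    rcases hx with h1 | h1
    · refine ⟨![0, 1], ![x (1, 0), x (1, 1)], ?_⟩
      rintro ⟨i, j⟩
      fin_cases i <;> fin_cases j <;> simp [h0, h1]
    · refine ⟨![x (0, 1), x (1, 1)], ![0, 1], ?_⟩
      rintro ⟨i, j⟩
      fin_cases i <;> fin_cases j <;> simp [h0, h1]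
  · refine ⟨![x (0, 0), x (1, 0)], ![1, x (0, 1) / x (0, 0)], ?_⟩
    rintro ⟨i, j⟩
    fin_cases i <;> fin_cases j <;> simp
    · field_simp
    · field_simp
      linear_combination hx

theorem vecMulVec_mem_separableCone_of_null {x : Fin 2 × Fin 2 → ℂ}
    (hx : x (0, 0) * x (1, 1) = x (0, 1) * x (1, 0)) :
    Matrix.vecMulVec x (star x) ∈ separableCone 2 := by
  obtain ⟨σ, hσ⟩ := separableStates_two_nonempty
  obtain ⟨a, b, hab⟩ := exists_eq_mul_of_null hx
  have hk : Matrix.vecMulVec x (star x) =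
      Matrix.vecMulVec a (star a) ⊗ₖ Matrix.vecMulVec b (star b) := by
    ext p q
    simp only [Matrix.vecMulVec_apply, Matrix.kroneckerMap_apply, Pi.star_apply, hab, star_mul']
    ring
  rcases eq_or_ne a 0 with rfl | ha
  · exact ⟨0, le_rfl, σ, hσ, by rw [hk]; simp⟩
  rcases eq_or_ne b 0 with rfl | hb
  · exact ⟨0, le_rfl, σ, hσ, by rw [hk]; simp⟩
  obtain ⟨c, hc, α, hα, hcα⟩ := exists_smul_quantumState ha
  obtain ⟨e, he, β, hβ, heβ⟩ := exists_smul_quantumState hb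
  refine ⟨c * e, mul_nonneg hc he, α ⊗ₖ β, subset_convexHull ℝ _ ⟨α, hα, β, hβ, rfl⟩, ?_⟩
  rw [hk, hcα, heβ, Matrix.smul_kronecker, Matrix.kronecker_smul, smul_smul]

/-! ### Takagi factorization through a real symmetric antilinear operator -/

theorem real_inner_eq_re_inner_euclidean {n : Type} [Fintype n] (x y : EuclideanSpace ℂ n) :
    inner ℝ x y = (inner ℂ x y).re := by
  simp [PiLp.inner_apply, Complex.re_sum]

/-- The real-linear operator `x ↦ conj (τ x)`. -/
def conjMulVec {n : Type} [Fintype n] (τ : Matrix n n ℂ) :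
    EuclideanSpace ℂ n →ₗ[ℝ] EuclideanSpace ℂ n where
  toFun x := WithLp.toLp 2 (star (τ *ᵥ x.ofLp))
  map_add' x y := by
    ext i; simp [Matrix.mulVec_add]
  map_smul' c x := by
    ext i; simp [Matrix.mulVec_smul]

theorem inner_conjMulVec {n : Type} [Fintype n] (τ : Matrix n n ℂ) (x y : EuclideanSpace ℂ n) :
    inner ℂ (conjMulVec τ x) y = y.ofLp ⬝ᵥ τ *ᵥ x.ofLp := by
  simp [conjMulVec, PiLp.inner_apply, dotProduct]

theorem conjMulVec_I_smul {n : Type} [Fintype n] (τ : Matrix n n ℂ) (x : EuclideanSpace ℂ n) :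
    conjMulVec τ (Complex.I • x) = -(Complex.I • conjMulVec τ x) := by
  ext i
  simp [conjMulVec, Matrix.mulVec_smul]

theorem isSymmetric_conjMulVec {n : Type} [Fintype n] {τ : Matrix n n ℂ} (hτ : τᵀ = τ) :
    (conjMulVec τ).IsSymmetric := by
  intro x y
  rw [real_inner_comm (conjMulVec τ y), real_inner_eq_re_inner_euclidean,
    real_inner_eq_re_inner_euclidean, inner_conjMulVec, inner_conjMulVec,
    Matrix.dotProduct_mulVec, ← Matrix.mulVec_transpose, hτ, dotProduct_comm]

/-- Eigenvectors of `x ↦ conj (τ x)` that are orthonormal over `ℝ` are orthonormal over `ℂ` if no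
two of the eigenvalues are opposite. -/
theorem orthonormal_complex_of_real {n : Type} [Fintype n] {τ : Matrix n n ℂ} (hτ : τᵀ = τ)
    {κ : Type*} {v : κ → EuclideanSpace ℂ n} {μ : κ → ℝ} (hv : Orthonormal ℝ v)
    (hμ : ∀ i, conjMulVec τ (v i) = μ i • v i) (hne : ∀ i j, μ i + μ j ≠ 0) :
    Orthonormal ℂ v := by
  classical
  rw [orthonormal_iff_ite] at hv ⊢
  intro i j
  have hre : (inner ℂ (v i) (v j)).re = if i = j then 1 else 0 := by
    rw [← real_inner_eq_re_inner_euclidean, hv]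
  -- By antilinearity `I • v j` has eigenvalue `-μ j`, which differs from `μ i`; symmetry makes it
  -- real-orthogonal to `v i`, killing the imaginary part of the complex inner product.
  have him : inner ℝ (v i) (Complex.I • v j) = 0 := by
    have h := isSymmetric_conjMulVec hτ (v i) (Complex.I • v j)
    rw [conjMulVec_I_smul, hμ, hμ, inner_neg_right, smul_comm, real_inner_smul_left,
      real_inner_smul_right] at h
    have : (μ i + μ j) * inner ℝ (v i) (Complex.I • v j) = 0 := by linarith
    exact (mul_eq_zero.1 this).resolve_left (hne i j)
  rw [real_inner_eq_re_inner_euclidean, inner_smul_right] at him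
  simp only [Complex.mul_re, Complex.I_re, zero_mul, Complex.I_im, one_mul, zero_sub,
    neg_eq_zero] at him
  apply Complex.ext
  · rw [hre]; split_ifs <;> simp
  · rw [him]; split_ifs <;> simp

/-- Takagi factorization of an invertible complex symmetric matrix. -/
theorem exists_unitary_transpose_mul_mul_eq_diagonal {n : Type} [Fintype n] [DecidableEq n]
    {τ : Matrix n n ℂ} (hτ : τᵀ = τ) (hdet : τ.det ≠ 0) :
    ∃ U ∈ Matrix.unitaryGroup n ℂ, ∃ σ : n → ℝ, (∀ i, 0 < σ i) ∧
      Uᵀ * τ * U = Matrix.diagonal (fun i => (σ i : ℂ)) := by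
  set m := Fintype.card n with hm
  have hfinC : Module.finrank ℂ (EuclideanSpace ℂ n) = m := finrank_euclideanSpace
  have hfin : Module.finrank ℝ (EuclideanSpace ℂ n) = 2 * m := by
    rw [finrank_real_of_complex, hfinC]
  have hT := isSymmetric_conjMulVec hτ
  set b := hT.eigenvectorBasis hfin with hb
  set μ := hT.eigenvalues hfin with hμdef
  have hμ : ∀ i, conjMulVec τ (b i) = μ i • b i := fun i => hT.apply_eigenvectorBasis hfin i
  have hμ0 : ∀ i, μ i ≠ 0 := by
    intro i h0
    have h := hμ i
    rw [h0, zero_smul] at h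
    have h1 : τ *ᵥ (b i).ofLp = 0 := by
      have := congrArg WithLp.ofLp h
      simpa [conjMulVec] using this
    have h2 : (b i).ofLp = 0 := Matrix.eq_zero_of_mulVec_eq_zero hdet h1
    have h3 : ‖b i‖ = 1 := b.orthonormal.1 i
    have h4 : b i = 0 := by ext j; simp [h2]
    rw [h4, norm_zero] at h3
    exact zero_ne_one h3
  have hP : Orthonormal ℂ (fun i : {i // 0 < μ i} => b i) :=
    orthonormal_complex_of_real hτ (b.orthonormal.comp _ Subtype.val_injective)
      (fun i => hμ i) (fun i j => (add_pos i.2 j.2).ne')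
  have hN : Orthonormal ℂ (fun i : {i // ¬ 0 < μ i} => b i) :=
    orthonormal_complex_of_real hτ (b.orthonormal.comp _ Subtype.val_injective)
      (fun i => hμ i) (fun i j => by
        have h1 := lt_of_le_of_ne (not_lt.1 i.2) (hμ0 i)
        have h2 := lt_of_le_of_ne (not_lt.1 j.2) (hμ0 j)
        exact (add_neg h1 h2).ne)
  -- The positive and the negative eigenvectors are each complex orthonormal, so at most m of each
  -- sign; there are 2m in all, so exactly m are positive, and they form the columns of U.
  have hPc := hP.linearIndependent.fintype_card_le_finrank
  have hNc := hN.linearIndependent.fintype_card_le_finrank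
  have hsum := Fintype.card_subtype_compl (fun i => 0 < μ i)
  have hle := Fintype.card_subtype_le (fun i => 0 < μ i)
  rw [hfinC] at hPc hNc
  rw [Fintype.card_fin] at hsum hle
  have hcard : Fintype.card n = Fintype.card {i // 0 < μ i} := by omega
  obtain ⟨e⟩ := Fintype.card_eq.1 hcard
  have hv : Orthonormal ℂ (fun i : n => b (e i)) := hP.comp e e.injective
  rw [orthonormal_iff_ite] at hv
  refine ⟨Matrix.of fun i j => b (e j) i, ?_, fun i => μ (e i), fun i => (e i).2, ?_⟩
  · rw [Matrix.mem_unitaryGroup_iff']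
    ext i j
    have := hv i j
    simp only [PiLp.inner_apply, RCLike.inner_apply] at this
    rw [Matrix.one_apply, ← this, Matrix.mul_apply]
    refine Finset.sum_congr rfl fun k _ => ?_
    simp [Matrix.star_apply, mul_comm]
  · ext i j
    have h1 : ((Matrix.of fun i j => b (e j) i)ᵀ * τ * (Matrix.of fun i j => b (e j) i)) i j
        = (b (e i)).ofLp ⬝ᵥ τ *ᵥ (b (e j)).ofLp := by
      rw [mul_assoc, Matrix.mul_apply]
      refine Finset.sum_congr rfl fun k _ => ?_
      simp [Matrix.mul_apply, Matrix.mulVec, dotProduct]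
    rw [h1, ← inner_conjMulVec, hμ, Matrix.diagonal_apply]
    have h2 : μ (e j) • b (e j) = (μ (e j) : ℂ) • b (e j) := by ext k; simp
    rw [h2, inner_smul_left, hv]
    by_cases hij : i = j
    · subst hij; simp
    · simp [hij, Ne.symm hij]

/-! ### The spin flip form and Lorentzian Hermitian forms -/

/-- The spin flip `σ_y ⊗ σ_y`, up to sign: the matrix of the polarized determinant. -/
def spinFlip : Matrix (Fin 2 × Fin 2) (Fin 2 × Fin 2) ℂ := !![0, 1; -1, 0] ⊗ₖ !![0, 1; -1, 0]

theorem spinFlip_transpose : spinFlipᵀ = spinFlip := by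
  ext ⟨i, j⟩ ⟨k, l⟩
  fin_cases i <;> fin_cases j <;> fin_cases k <;> fin_cases l <;> simp [spinFlip]

theorem spinFlip_conjTranspose : spinFlipᴴ = spinFlip := by
  ext ⟨i, j⟩ ⟨k, l⟩
  fin_cases i <;> fin_cases j <;> fin_cases k <;> fin_cases l <;> simp [spinFlip]

theorem spinFlip_mul_self : spinFlip * spinFlip = 1 := by
  rw [spinFlip, ← Matrix.mul_kronecker_mul]
  have : (!![0, 1; -1, 0] : Matrix (Fin 2) (Fin 2) ℂ) * !![0, 1; -1, 0] = -1 := by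
    ext i j; fin_cases i <;> fin_cases j <;> simp
  rw [this]
  ext ⟨i, j⟩ ⟨k, l⟩
  fin_cases i <;> fin_cases j <;> fin_cases k <;> fin_cases l <;> simp

theorem spinFlip_det : spinFlip.det = 1 := by
  rw [spinFlip, Matrix.det_kronecker]
  simp [Matrix.det_fin_two]

theorem spinFlip_apply_self (i : Fin 2 × Fin 2) : spinFlip i i = 0 := by
  obtain ⟨i, j⟩ := i
  fin_cases i <;> fin_cases j <;> simp [spinFlip]

theorem dotProduct_spinFlip_self (x : Fin 2 × Fin 2 → ℂ) :
    x ⬝ᵥ spinFlip *ᵥ x = 2 * (x (0, 0) * x (1, 1) - x (0, 1) * x (1, 0)) := by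
  simp [spinFlip, dotProduct, Matrix.mulVec, Fintype.sum_prod_type, Fin.sum_univ_two]
  ring

/-- The signature `(-1, 1, 1, 1)`, with the negative sign in place `k`. -/
def lorentzSign {n : Type} [DecidableEq n] (k i : n) : ℝ := if i = k then -1 else 1

/-- The Lorentzian Hermitian form diagonalized by the rows of `R`. -/
def lorentzForm {n : Type} [Fintype n] [DecidableEq n] (k : n) (R : Matrix n n ℂ) :
    Matrix n n ℂ :=
  Rᴴ * Matrix.diagonal (fun i => (lorentzSign k i : ℂ)) * R

theorem lorentzSign_mul_self {n : Type} [DecidableEq n] (k i : n) :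
    lorentzSign k i * lorentzSign k i = 1 := by
  unfold lorentzSign; split_ifs <;> norm_num

theorem isHermitian_lorentzForm {n : Type} [Fintype n] [DecidableEq n] (k : n)
    (R : Matrix n n ℂ) : (lorentzForm k R).IsHermitian := by
  unfold lorentzForm Matrix.IsHermitian
  rw [Matrix.conjTranspose_mul, Matrix.conjTranspose_mul, Matrix.conjTranspose_conjTranspose,
    Matrix.diagonal_conjTranspose, mul_assoc]
  congr 3
  ext i
  simp

/-- The hypothesis on R, in transposed and conjugated form, cancels the inner factors, and the
signature squares to one. Thus the inverse is similar to the transpose, and the spectrum is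
invariant under inversion. -/
theorem lorentzForm_mul_flip {R : Matrix (Fin 2 × Fin 2) (Fin 2 × Fin 2) ℂ}
    (hR : Rᵀ * R = spinFlip) (k : Fin 2 × Fin 2) :
    lorentzForm k R * (spinFlip * (lorentzForm k R)ᵀ * spinFlip) = 1 := by
  set J : Matrix (Fin 2 × Fin 2) (Fin 2 × Fin 2) ℂ :=
    Matrix.diagonal (fun i => (lorentzSign k i : ℂ)) with hJ
  have hJJ : J * J = 1 := by
    rw [hJ, Matrix.diagonal_mul_diagonal, ← Matrix.diagonal_one]
    congr 1; ext i
    exact_mod_cast lorentzSign_mul_self k i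
  have hJt : Jᵀ = J := Matrix.diagonal_transpose _
  have h1 : (spinFlip * Rᵀ) * R = 1 := by rw [mul_assoc, hR, spinFlip_mul_self]
  have h2 : R * spinFlip * Rᵀ = 1 := by rw [mul_assoc]; exact mul_eq_one_comm.1 h1
  have h3 : Rᴴ * Rᴴᵀ = spinFlip := by
    have := congrArg Matrix.conjTranspose hR
    rw [Matrix.conjTranspose_mul, spinFlip_conjTranspose] at this
    rw [← this]; rfl
  have hY : lorentzForm k R = Rᴴ * J * R := rfl
  rw [hY, Matrix.transpose_mul, Matrix.transpose_mul, hJt]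
  calc Rᴴ * J * R * (spinFlip * (Rᵀ * (J * Rᴴᵀ)) * spinFlip)
      = Rᴴ * J * (R * spinFlip * Rᵀ) * J * Rᴴᵀ * spinFlip := by simp only [mul_assoc]
    _ = Rᴴ * (J * J) * Rᴴᵀ * spinFlip := by rw [h2, mul_one, mul_assoc Rᴴ]
    _ = 1 := by rw [hJJ, mul_one, h3, spinFlip_mul_self]

theorem det_lorentzForm {R : Matrix (Fin 2 × Fin 2) (Fin 2 × Fin 2) ℂ}
    (hR : Rᵀ * R = spinFlip) (k : Fin 2 × Fin 2) : (lorentzForm k R).det = -1 := by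
  have h := congrArg Matrix.det hR
  rw [Matrix.det_mul, Matrix.det_transpose, spinFlip_det] at h
  have hJ : (∏ i, (lorentzSign k i : ℂ)) = -1 := by
    simp [lorentzSign, apply_ite, Finset.prod_ite_eq']
  rw [lorentzForm, Matrix.det_mul, Matrix.det_mul, Matrix.det_conjTranspose,
    Matrix.det_diagonal, hJ]
  rcases mul_self_eq_one_iff.1 h with h | h <;> rw [h] <;> simp

/-- The spin flip has zero diagonal, so the squares in column j of R sum to zero; the triangle
inequality bounds the modulus of the k-th square by the sum of the other moduli. This fixes the sign
of the trace. -/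
theorem lorentzForm_apply_self_nonneg {R : Matrix (Fin 2 × Fin 2) (Fin 2 × Fin 2) ℂ}
    (hR : Rᵀ * R = spinFlip) (k j : Fin 2 × Fin 2) : 0 ≤ (lorentzForm k R j j).re := by
  have h0 : ∑ i, R i j * R i j = 0 := by
    have := congrFun (congrFun hR j) j
    rwa [spinFlip_apply_self, Matrix.mul_apply] at this
  have h1 : (lorentzForm k R j j).re = ∑ i, lorentzSign k i * ‖R i j‖ ^ 2 := by
    rw [lorentzForm, Matrix.mul_apply, Complex.re_sum]
    refine Finset.sum_congr rfl fun i _ => ?_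
    rw [Matrix.mul_diagonal, Matrix.conjTranspose_apply, ← Complex.normSq_eq_norm_sq, Complex.normSq_apply]
    simp
    ring
  rw [h1, ← Finset.add_sum_erase _ _ (Finset.mem_univ k)]
  rw [← Finset.add_sum_erase _ _ (Finset.mem_univ k)] at h0
  have h2 : ‖R k j‖ ^ 2 ≤ ∑ i ∈ Finset.univ.erase k, ‖R i j‖ ^ 2 := by
    calc ‖R k j‖ ^ 2 = ‖R k j * R k j‖ := by rw [norm_mul, sq]
      _ = ‖∑ i ∈ Finset.univ.erase k, R i j * R i j‖ := by
          rw [eq_neg_of_add_eq_zero_left h0, norm_neg]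
      _ ≤ _ := (norm_sum_le _ _).trans (by simp [sq])
  have h3 : ∑ i ∈ Finset.univ.erase k, lorentzSign k i * ‖R i j‖ ^ 2 =
      ∑ i ∈ Finset.univ.erase k, ‖R i j‖ ^ 2 :=
    Finset.sum_congr rfl fun i hi => by simp [lorentzSign, Finset.ne_of_mem_erase hi]
  rw [h3]
  simp only [lorentzSign, if_true]
  linarith

/-! ### Spectral bounds for Lorentzian forms -/

/-- Four real numbers with product `-1` whose multiset has the same first two power sums as that of
the inverses: the spectrum is `-1, 1, s, s⁻¹`. -/
theorem bounds_of_inverse_invariant {a b c d : ℝ} (hp : a * b * c * d = -1)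
    (h1 : a⁻¹ + b⁻¹ + c⁻¹ + d⁻¹ = a + b + c + d)
    (h2 : a⁻¹ ^ 2 + b⁻¹ ^ 2 + c⁻¹ ^ 2 + d⁻¹ ^ 2 = a ^ 2 + b ^ 2 + c ^ 2 + d ^ 2)
    (hpos : 0 ≤ a + b + c + d) :
    -1 ≤ a ∧ a + 1 ≤ (Real.sqrt 2 + 1) / 2 * (a + b + c + d) := by
  set e := a + b + c + d with he
  have ha : a ≠ 0 := by rintro rfl; norm_num at hp
  have hb : b ≠ 0 := by rintro rfl; norm_num at hp
  have hc : c ≠ 0 := by rintro rfl; norm_num at hp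
  have hd : d ≠ 0 := by rintro rfl; norm_num at hp
  have ia : a⁻¹ = -(b * c * d) := by
    rw [inv_eq_iff_eq_inv, eq_comm, inv_eq_of_mul_eq_one_left]
    linarith
  have ib : b⁻¹ = -(a * c * d) := by
    rw [inv_eq_iff_eq_inv, eq_comm, inv_eq_of_mul_eq_one_left]
    linarith
  have ic : c⁻¹ = -(a * b * d) := by
    rw [inv_eq_iff_eq_inv, eq_comm, inv_eq_of_mul_eq_one_left]
    linarith
  have id' : d⁻¹ = -(a * b * c) := by
    rw [inv_eq_iff_eq_inv, eq_comm, inv_eq_of_mul_eq_one_left]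
    linarith
  rw [ia, ib, ic, id'] at h1 h2
  -- The second elementary symmetric function of the inverses is e₂ divided by the product, that is
  -- -e₂; the power sums say that it also equals e₂.
  have e2 : a * b + a * c + a * d + b * c + b * d + c * d = 0 := by
    have h3 : (-(b * c * d) + -(a * c * d) + -(a * b * d) + -(a * b * c)) ^ 2 = e ^ 2 := by rw [h1]
    have h4 : e ^ 2 - (a ^ 2 + b ^ 2 + c ^ 2 + d ^ 2) =
        2 * (a * b + a * c + a * d + b * c + b * d + c * d) := by rw [he]; ring
    have h5 : (-(b * c * d) + -(a * c * d) + -(a * b * d) + -(a * b * c)) ^ 2 -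
        ((-(b * c * d)) ^ 2 + (-(a * c * d)) ^ 2 + (-(a * b * d)) ^ 2 + (-(a * b * c)) ^ 2) =
        2 * (a * b * c * d) * (a * b + a * c + a * d + b * c + b * d + c * d) := by ring
    rw [hp] at h5
    linarith
  have root : ∀ x, (x - a) * (x - b) * (x - c) * (x - d) = (x ^ 2 - 1) * (x ^ 2 - e * x + 1) := by
    intro x
    linear_combination x ^ 2 * e2 + x * h1 + hp
  have alt : ∀ x, (x - a) * (x - b) * (x - c) * (x - d) = 0 →
      x = 1 ∨ x = -1 ∨ x ^ 2 - e * x + 1 = 0 := by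
    intro x hx
    rw [root, mul_eq_zero] at hx
    rcases hx with hx | hx
    · rcases mul_self_eq_one_iff.1 (by linarith : x * x = 1) with h | h
      · exact Or.inl h
      · exact Or.inr (Or.inl h)
    · exact Or.inr (Or.inr hx)
  have posx : ∀ x, x ^ 2 - e * x + 1 = 0 → 0 < x := by
    intro x hx
    by_contra hn
    nlinarith [mul_nonneg hpos (neg_nonneg.2 (not_lt.1 hn)), sq_nonneg x]
  have ge2 : ∀ x, x ^ 2 - e * x + 1 = 0 → 2 ≤ e := by
    intro x hx
    have h := posx x hx
    by_contra hn
    nlinarith [mul_pos h (sub_pos.2 (not_le.1 hn)), sq_nonneg (x - 1)]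
  -- A root of the quadratic factor forces e ≥ 2. Otherwise all four numbers are ±1 with product -1,
  -- so their sum is ±2.
  have he2 : 2 ≤ e := by
    rcases alt a (by ring) with ha | ha | ha
    rotate_left 2
    · exact ge2 _ ha
    all_goals
      rcases alt b (by ring) with hb | hb | hb
      rotate_left 2
      · exact ge2 _ hb
      all_goals
        rcases alt c (by ring) with hc | hc | hc
        rotate_left 2
        · exact ge2 _ hc
        all_goals
          rcases alt d (by ring) with hd | hd | hd
          rotate_left 2
          · exact ge2 _ hd
          all_goals
            rw [ha, hb, hc, hd] at hp he
            first
            | (exfalso; norm_num at hp; done)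
            | linarith
  have hs := Real.sq_sqrt (show (0 : ℝ) ≤ 2 by norm_num)
  have hs1 : 1 ≤ Real.sqrt 2 := Real.one_le_sqrt.2 (by norm_num)
  rcases alt a (by ring) with h | h | h
  · rw [h]; exact ⟨by norm_num, by nlinarith⟩
  · rw [h]; exact ⟨le_rfl, by nlinarith⟩
  · have hx := posx a h
    refine ⟨by linarith, ?_⟩
    -- After multiplication by a, with ae = a² + 1, the gap is a perfect square vanishing at a = √2
    -- + 1; this is the origin of the constant.
    have key : 0 ≤ a * ((Real.sqrt 2 + 1) / 2 * e - (a + 1)) := by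
      have : a * ((Real.sqrt 2 + 1) / 2 * e - (a + 1)) =
          (Real.sqrt 2 - 1) / 2 * (a - (Real.sqrt 2 + 1)) ^ 2 := by
        linear_combination (-(Real.sqrt 2 + 1) / 2) * h + (a - (Real.sqrt 2 + 1) / 2) * hs
      rw [this]
      exact mul_nonneg (by linarith) (sq_nonneg _)
    have := nonneg_of_mul_nonneg_right key hx
    linarith

/-- The expectation value of an observable is a convex combination of its eigenvalues. -/
theorem expectation_eq_sum_eigenvalues {n : Type} [Fintype n] [DecidableEq n] {A : Matrix n n ℂ}
    (hA : A.IsHermitian) {ρ : Matrix n n ℂ} (hρ : ρ ∈ quantumStates n) :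
    ∃ w : n → ℝ, (∀ i, 0 ≤ w i) ∧ ∑ i, w i = 1 ∧
      expectation A ρ = ∑ i, hA.eigenvalues i * w i := by
  set V : Matrix n n ℂ := (hA.eigenvectorUnitary : Matrix n n ℂ) with hV
  have hVV : V * Vᴴ = 1 := Unitary.coe_mul_star_self hA.eigenvectorUnitary
  have hspec : A = V * Matrix.diagonal (fun i => (hA.eigenvalues i : ℂ)) * Vᴴ := by
    conv_lhs => rw [hA.spectral_theorem]
    rfl
  generalize hA.eigenvalues = μ at hspec ⊢
  have hpos : (Vᴴ * ρ * V).PosSemidef := hρ.1.conjTranspose_mul_mul_same V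
  refine ⟨fun i => ((Vᴴ * ρ * V) i i).re, fun i => (Complex.nonneg_iff.1 hpos.diag_nonneg).1,
    ?_, ?_⟩
  · have h : (Vᴴ * ρ * V).trace = 1 := by rw [Matrix.trace_mul_cycle, hVV, one_mul, hρ.2]
    rw [← Complex.re_sum]
    exact congrArg Complex.re h
  · have h : (ρ * A).trace = (Matrix.diagonal (fun i => (μ i : ℂ)) * (Vᴴ * ρ * V)).trace := by
      rw [hspec, ← mul_assoc, Matrix.trace_mul_comm, Matrix.trace_mul_comm (Matrix.diagonal _)]
      simp only [mul_assoc]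
    rw [expectation, h, Matrix.trace, Complex.re_sum]
    refine Finset.sum_congr rfl fun i _ => ?_
    rw [Matrix.diag_apply, Matrix.diagonal_mul, Complex.re_ofReal_mul]

theorem le_expectation {n : Type} [Fintype n] [DecidableEq n] {A : Matrix n n ℂ}
    (hA : A.IsHermitian) {c : ℝ} (hc : ∀ i, c ≤ hA.eigenvalues i) {ρ : Matrix n n ℂ}
    (hρ : ρ ∈ quantumStates n) : c ≤ expectation A ρ := by
  obtain ⟨w, hw, hs, h⟩ := expectation_eq_sum_eigenvalues hA hρ
  rw [h, ← mul_one c, ← hs, Finset.mul_sum]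
  exact Finset.sum_le_sum fun i _ => mul_le_mul_of_nonneg_right (hc i) (hw i)

theorem expectation_le {n : Type} [Fintype n] [DecidableEq n] {A : Matrix n n ℂ}
    (hA : A.IsHermitian) {c : ℝ} (hc : ∀ i, hA.eigenvalues i ≤ c) {ρ : Matrix n n ℂ}
    (hρ : ρ ∈ quantumStates n) : expectation A ρ ≤ c := by
  obtain ⟨w, hw, hs, h⟩ := expectation_eq_sum_eigenvalues hA hρ
  rw [h, ← mul_one c, ← hs, Finset.mul_sum]
  exact Finset.sum_le_sum fun i _ => mul_le_mul_of_nonneg_right (hc i) (hw i)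

theorem vecMulVec_mem_quantumStates {n : Type} [Fintype n] {x : n → ℂ} (hx : star x ⬝ᵥ x = 1) :
    Matrix.vecMulVec x (star x) ∈ quantumStates n :=
  ⟨posSemidef_vecMulVec_star x, by rw [Matrix.trace_vecMulVec, dotProduct_comm, hx]⟩

/-- A Hermitian matrix whose inverse is similar to its transpose has the same power sums of
eigenvalues and of inverse eigenvalues. -/
theorem sum_eigenvalues_inv_pow {n : Type} [Fintype n] [DecidableEq n] {A S : Matrix n n ℂ}
    (hA : A.IsHermitian) (hS : S * S = 1) (h : A * (S * Aᵀ * S) = 1)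
    (h0 : ∀ i, hA.eigenvalues i ≠ 0) (k : ℕ) :
    ∑ i, (hA.eigenvalues i)⁻¹ ^ k = ∑ i, hA.eigenvalues i ^ k := by
  set V : Matrix n n ℂ := (hA.eigenvectorUnitary : Matrix n n ℂ) with hV
  have hVV : V * Vᴴ = 1 := Unitary.coe_mul_star_self hA.eigenvectorUnitary
  have hVV' : Vᴴ * V = 1 := Unitary.coe_star_mul_self hA.eigenvectorUnitary
  have hpow : ∀ d : n → ℂ, (V * Matrix.diagonal d * Vᴴ) ^ k = V * Matrix.diagonal (d ^ k) * Vᴴ := by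
    intro d
    have : SemiconjBy V (Matrix.diagonal d) (V * Matrix.diagonal d * Vᴴ) := by
      unfold SemiconjBy
      rw [mul_assoc _ Vᴴ, hVV', mul_one]
    rw [← Matrix.diagonal_pow, (this.pow_right k).eq, mul_assoc (_ ^ k), hVV, mul_one]
  have htr : ∀ d : n → ℂ, (V * Matrix.diagonal d * Vᴴ).trace = ∑ i, d i := by
    intro d
    rw [Matrix.trace_mul_cycle, hVV', one_mul, Matrix.trace_diagonal]
  have hspec : A = V * Matrix.diagonal (fun i => (hA.eigenvalues i : ℂ)) * Vᴴ := by
    conv_lhs => rw [hA.spectral_theorem]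
    rfl
  generalize hA.eigenvalues = μ at hspec h0 ⊢
  have hinv : S * Aᵀ * S = V * Matrix.diagonal (fun i => ((μ i : ℂ))⁻¹) * Vᴴ := by
    have h1 : A * (V * Matrix.diagonal (fun i => ((μ i : ℂ))⁻¹) * Vᴴ) = 1 := by
      conv_lhs => rw [hspec]
      calc V * Matrix.diagonal (fun i => (μ i : ℂ)) * Vᴴ *
            (V * Matrix.diagonal (fun i => ((μ i : ℂ))⁻¹) * Vᴴ)
          = V * (Matrix.diagonal (fun i => (μ i : ℂ)) * (Vᴴ * V) *
            Matrix.diagonal (fun i => ((μ i : ℂ))⁻¹)) * Vᴴ := by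
              simp only [mul_assoc]
        _ = 1 := by
          rw [hVV', mul_one, Matrix.diagonal_mul_diagonal]
          have : (fun i => (μ i : ℂ) * ((μ i : ℂ))⁻¹) = fun _ => 1 := by
            ext i
            exact mul_inv_cancel₀ (Complex.ofReal_ne_zero.2 (h0 i))
          rw [this, Matrix.diagonal_one, mul_one, hVV]
    have h2 := mul_eq_one_comm.1 h
    rw [← mul_one (S * Aᵀ * S), ← h1, ← mul_assoc, h2, one_mul]
  have hk : ((S * Aᵀ * S) ^ k).trace = (A ^ k).trace := by
    have : SemiconjBy S Aᵀ (S * Aᵀ * S) := by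
      unfold SemiconjBy
      rw [mul_assoc _ S, hS, mul_one]
    have h2 : (S * Aᵀ * S) ^ k = S * Aᵀ ^ k * S := by
      rw [(this.pow_right k).eq, mul_assoc (_ ^ k), hS, mul_one]
    rw [h2, Matrix.trace_mul_cycle, hS, one_mul, ← Matrix.transpose_pow, Matrix.trace_transpose]
  rw [hinv, hpow, htr] at hk
  conv_rhs at hk => rw [hspec]
  rw [hpow, htr] at hk
  simp only [Pi.pow_apply] at hk
  exact_mod_cast hk

theorem eigenvalues_lorentzForm {R : Matrix (Fin 2 × Fin 2) (Fin 2 × Fin 2) ℂ}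
    (hR : Rᵀ * R = spinFlip) (k i : Fin 2 × Fin 2) :
    -1 ≤ (isHermitian_lorentzForm k R).eigenvalues i ∧
      (isHermitian_lorentzForm k R).eigenvalues i + 1 ≤
        (Real.sqrt 2 + 1) / 2 * (lorentzForm k R).trace.re := by
  set hY := isHermitian_lorentzForm k R
  set μ := hY.eigenvalues with hμ
  have hprod : ∏ i, μ i = -1 := by
    have := hY.det_eq_prod_eigenvalues
    rw [det_lorentzForm hR] at this
    have h2 : (∏ i, (μ i : ℂ)) = -1 := this.symm
    exact_mod_cast h2
  have h0 : ∀ i, μ i ≠ 0 := by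
    intro i hi
    rw [Finset.prod_eq_zero (Finset.mem_univ i) hi] at hprod
    norm_num at hprod
  have h1 := sum_eigenvalues_inv_pow hY spinFlip_mul_self (lorentzForm_mul_flip hR k) h0 1
  have h2 := sum_eigenvalues_inv_pow hY spinFlip_mul_self (lorentzForm_mul_flip hR k) h0 2
  have htr : (lorentzForm k R).trace.re = ∑ i, μ i := by
    rw [hY.trace_eq_sum_eigenvalues, ← RCLike.ofReal_sum]
    exact Complex.ofReal_re _
  have hpos : 0 ≤ (lorentzForm k R).trace.re := by
    rw [Matrix.trace, Complex.re_sum]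
    exact Finset.sum_nonneg fun j _ => lorentzForm_apply_self_nonneg hR k j
  rw [htr] at hpos ⊢
  simp only [← hμ, pow_one, Fintype.sum_prod_type, Fintype.prod_prod_type, Fin.sum_univ_two,
    Fin.prod_univ_two] at h1 h2 hprod hpos ⊢
  revert i
  rw [Prod.forall]
  simp only [Fin.forall_fin_two]
  -- The bounds concern the first of the four numbers, so each eigenvalue is moved to the front in
  -- turn.
  have h00 := @bounds_of_inverse_invariant (μ (0, 0)) (μ (0, 1)) (μ (1, 0)) (μ (1, 1))
    (by linarith) (by linarith) (by linarith) (by linarith)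
  have h01 := @bounds_of_inverse_invariant (μ (0, 1)) (μ (0, 0)) (μ (1, 0)) (μ (1, 1))
    (by linarith) (by linarith) (by linarith) (by linarith)
  have h10 := @bounds_of_inverse_invariant (μ (1, 0)) (μ (0, 1)) (μ (0, 0)) (μ (1, 1))
    (by linarith) (by linarith) (by linarith) (by linarith)
  have h11 := @bounds_of_inverse_invariant (μ (1, 1)) (μ (0, 1)) (μ (1, 0)) (μ (0, 0))
    (by linarith) (by linarith) (by linarith) (by linarith)
  exact ⟨⟨⟨h00.1, h00.2.trans_eq (by ring)⟩, h01.1, h01.2.trans_eq (by ring)⟩,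
    ⟨h10.1, h10.2.trans_eq (by ring)⟩, h11.1, h11.2.trans_eq (by ring)⟩

/-! ### Tilted states against Lorentzian forms -/

/-- The maximally mixed two-qubit state, with the weight `(√2 - 1) / 2` moved from `φ` to `ψ`. -/
noncomputable def tiltedState (ψ φ : Fin 2 × Fin 2 → ℂ) : Matrix (Fin 2 × Fin 2) (Fin 2 × Fin 2) ℂ :=
  (1 / 4 : ℝ) • 1 + ((Real.sqrt 2 - 1) / 2 : ℝ) •
    (Matrix.vecMulVec ψ (star ψ) - Matrix.vecMulVec φ (star φ))

theorem expectation_tiltedState (A : Matrix (Fin 2 × Fin 2) (Fin 2 × Fin 2) ℂ)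
    (ψ φ : Fin 2 × Fin 2 → ℂ) :
    expectation A (tiltedState ψ φ) = 1 / 4 * A.trace.re + (Real.sqrt 2 - 1) / 2 *
      (expectation A (Matrix.vecMulVec ψ (star ψ)) -
        expectation A (Matrix.vecMulVec φ (star φ))) := by
  simp only [expectation]
  rw [tiltedState, add_mul, smul_mul_assoc, smul_mul_assoc, one_mul, sub_mul, Matrix.trace_add,
    Matrix.trace_smul, Matrix.trace_smul, Matrix.trace_sub]
  simp

/-- The lower spectral bound is used at ψ and the upper one at φ; since (√2 - 1)(√2 + 1) = 1, the
trace terms cancel exactly. -/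
theorem expectation_lorentzForm_tiltedState_nonneg
    {R : Matrix (Fin 2 × Fin 2) (Fin 2 × Fin 2) ℂ}
    (hR : Rᵀ * R = spinFlip) (k : Fin 2 × Fin 2) {ψ φ : Fin 2 × Fin 2 → ℂ}
    (hψ : star ψ ⬝ᵥ ψ = 1) (hφ : star φ ⬝ᵥ φ = 1) :
    0 ≤ expectation (lorentzForm k R) (tiltedState ψ φ) := by
  have h1 := le_expectation (isHermitian_lorentzForm k R)
    (fun i => (eigenvalues_lorentzForm hR k i).1) (vecMulVec_mem_quantumStates hψ)
  have h2 := expectation_le (isHermitian_lorentzForm k R)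
    (fun i => le_sub_iff_add_le.2 (eigenvalues_lorentzForm hR k i).2)
    (vecMulVec_mem_quantumStates hφ)
  rw [expectation_tiltedState]
  generalize expectation (lorentzForm k R) (Matrix.vecMulVec ψ (star ψ)) = x at h1 ⊢
  generalize expectation (lorentzForm k R) (Matrix.vecMulVec φ (star φ)) = y at h2 ⊢
  generalize (lorentzForm k R).trace.re = z at h2 ⊢
  have hs := Real.sq_sqrt (show (0 : ℝ) ≤ 2 by norm_num)
  have hs1 : 1 ≤ Real.sqrt 2 := Real.one_le_sqrt.2 (by norm_num)
  have h4 : 0 ≤ (Real.sqrt 2 - 1) / 2 * (x - y + (Real.sqrt 2 + 1) / 2 * z) :=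
    mul_nonneg (by linarith) (by linarith)
  have h5 : (Real.sqrt 2 - 1) / 2 * ((Real.sqrt 2 + 1) / 2 * z) = 1 / 4 * z := by
    linear_combination z / 4 * hs
  linarith [mul_add ((Real.sqrt 2 - 1) / 2) (x - y) ((Real.sqrt 2 + 1) / 2 * z)]

/-! ### Separability from a frame orthonormal for the spin flip form -/

/-- The vectors with each coordinate at most the sum of the others form the cone generated by the
sums of two distinct unit vectors. -/
theorem exists_pair_weights {a b c d : ℝ} (ha : 0 ≤ a) (hb : 0 ≤ b) (hc : 0 ≤ c) (hd : 0 ≤ d)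
    (h1 : a ≤ b + c + d) (h2 : b ≤ a + c + d) (h3 : c ≤ a + b + d) (h4 : d ≤ a + b + c) :
    ∃ ab ac ad bc bd cd : ℝ, 0 ≤ ab ∧ 0 ≤ ac ∧ 0 ≤ ad ∧ 0 ≤ bc ∧ 0 ≤ bd ∧ 0 ≤ cd ∧
      a = ab + ac + ad ∧ b = ab + bc + bd ∧ c = ac + bc + cd ∧ d = ad + bd + cd := by
  -- The hypotheses say that no entry exceeds the half sum s. In each case two of the six weights
  -- are set to zero and the equations force the other four.
  obtain ⟨s, hs⟩ : ∃ s, s = (a + b + c + d) / 2 := ⟨_, rfl⟩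
  rcases le_total 0 (a + b - s) with h | h
  · rcases le_total 0 (b + c - s) with h' | h'
    · exact ⟨a + b - s, s - b, 0, b + c - s, d, 0, by linarith, by linarith, by linarith,
        by linarith, by linarith, by linarith, by linarith, by linarith, by linarith, by linarith⟩
    · exact ⟨a + b - s, c, s - b - c, 0, s - a, 0, by linarith, by linarith, by linarith,
        by linarith, by linarith, by linarith, by linarith, by linarith, by linarith, by linarith⟩
  · rcases le_total 0 (d + a - s) with h' | h'
    · exact ⟨0, s - d, d + a - s, 0, b, c + d - s, by linarith, by linarith, by linarith,
        by linarith, by linarith, by linarith, by linarith, by linarith, by linarith, by linarith⟩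
    · exact ⟨0, a, 0, s - d - a, s - c, c + d - s, by linarith, by linarith, by linarith,
        by linarith, by linarith, by linarith, by linarith, by linarith, by linarith, by linarith⟩

/-- The vectors x ± iy are null for the spin flip form, hence product vectors, and the cross terms
cancel in the average of their projections. -/
theorem vecMulVec_add_mem_separableCone {x y : Fin 2 × Fin 2 → ℂ} (hx : x ⬝ᵥ spinFlip *ᵥ x = 1)
    (hy : y ⬝ᵥ spinFlip *ᵥ y = 1) (hxy : x ⬝ᵥ spinFlip *ᵥ y = 0) :
    Matrix.vecMulVec x (star x) + Matrix.vecMulVec y (star y) ∈ separableCone 2 := by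
  have hyx : y ⬝ᵥ spinFlip *ᵥ x = 0 := by
    rw [Matrix.dotProduct_mulVec, ← Matrix.mulVec_transpose, spinFlip_transpose, dotProduct_comm,
      hxy]
  have null : ∀ z : Fin 2 × Fin 2 → ℂ, z ⬝ᵥ spinFlip *ᵥ z = 0 →
      Matrix.vecMulVec z (star z) ∈ separableCone 2 := by
    intro z hz
    rw [dotProduct_spinFlip_self] at hz
    exact vecMulVec_mem_separableCone_of_null (by linear_combination hz / 2)
  have h1 := null (x + Complex.I • y) (by
    simp only [Matrix.mulVec_add, Matrix.mulVec_smul, add_dotProduct, dotProduct_add,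
      smul_dotProduct, dotProduct_smul, hx, hy, hxy, hyx, smul_eq_mul]
    linear_combination Complex.I_mul_I)
  have h2 := null (x - Complex.I • y) (by
    simp only [Matrix.mulVec_sub, Matrix.mulVec_smul, sub_dotProduct, dotProduct_sub,
      smul_dotProduct, dotProduct_smul, hx, hy, hxy, hyx, smul_eq_mul]
    linear_combination Complex.I_mul_I)
  have h3 := smul_mem_separableCone (add_mem_separableCone h1 h2)
    (show (0 : ℝ) ≤ 1 / 2 by norm_num)
  convert h3 using 1
  ext i j
  simp [Matrix.vecMulVec_apply]
  linear_combination (y i * (starRingEnd ℂ) (y j)) * Complex.I_mul_I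

theorem spinFlip_mul_mul_apply (F : Matrix (Fin 2 × Fin 2) (Fin 2 × Fin 2) ℂ)
    (i j : Fin 2 × Fin 2) : (Fᵀ * spinFlip * F) i j = Fᵀ i ⬝ᵥ spinFlip *ᵥ Fᵀ j := by
  rw [mul_assoc, Matrix.mul_apply]
  rfl

theorem mul_diagonal_mul_conjTranspose_eq_sum {n : Type} [Fintype n] [DecidableEq n]
    (F : Matrix n n ℂ) (σ : n → ℝ) :
    F * Matrix.diagonal (fun i => (σ i : ℂ)) * Fᴴ =
      ∑ i, σ i • Matrix.vecMulVec (Fᵀ i) (star (Fᵀ i)) := by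
  ext p q
  rw [Matrix.mul_apply, Matrix.sum_apply]
  refine Finset.sum_congr rfl fun i _ => ?_
  simp only [Matrix.mul_diagonal, Matrix.conjTranspose_apply, Matrix.smul_apply,
    Matrix.vecMulVec_apply, Matrix.transpose_apply, Pi.star_apply, Complex.real_smul]
  ring

/-- A state diagonalized by a frame that is orthonormal for the spin flip form lies in the
separable cone if every weight is at most the sum of the others. -/
theorem mul_diagonal_mul_mem_separableCone {F : Matrix (Fin 2 × Fin 2) (Fin 2 × Fin 2) ℂ}
    (hF : Fᵀ * spinFlip * F = 1) {σ : Fin 2 × Fin 2 → ℝ} (hσ : ∀ i, 0 ≤ σ i)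
    (h : ∀ k, 0 ≤ ∑ i, lorentzSign k i * σ i) :
    F * Matrix.diagonal (fun i => (σ i : ℂ)) * Fᴴ ∈ separableCone 2 := by
  have pair : ∀ i j, i ≠ j → Matrix.vecMulVec (Fᵀ i) (star (Fᵀ i)) +
      Matrix.vecMulVec (Fᵀ j) (star (Fᵀ j)) ∈ separableCone 2 := by
    intro i j hij
    apply vecMulVec_add_mem_separableCone
    · rw [← spinFlip_mul_mul_apply, hF, Matrix.one_apply_eq]
    · rw [← spinFlip_mul_mul_apply, hF, Matrix.one_apply_eq]
    · rw [← spinFlip_mul_mul_apply, hF, Matrix.one_apply_ne hij]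
  have hk := fun k => h k
  simp only [lorentzSign, Fintype.sum_prod_type, Fin.sum_univ_two] at hk
  have k00 := hk (0, 0)
  have k01 := hk (0, 1)
  have k10 := hk (1, 0)
  have k11 := hk (1, 1)
  simp at k00 k01 k10 k11
  obtain ⟨ab, ac, ad, bc, bd, cd, h1, h2, h3, h4, h5, h6, e1, e2, e3, e4⟩ :=
    exists_pair_weights (hσ (0, 0)) (hσ (0, 1)) (hσ (1, 0)) (hσ (1, 1))
      (by linarith) (by linarith) (by linarith) (by linarith)
  have p1 := smul_mem_separableCone (pair (0, 0) (0, 1) (by simp)) h1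
  have p2 := smul_mem_separableCone (pair (0, 0) (1, 0) (by simp)) h2
  have p3 := smul_mem_separableCone (pair (0, 0) (1, 1) (by simp)) h3
  have p4 := smul_mem_separableCone (pair (0, 1) (1, 0) (by simp)) h4
  have p5 := smul_mem_separableCone (pair (0, 1) (1, 1) (by simp)) h5
  have p6 := smul_mem_separableCone (pair (1, 0) (1, 1) (by simp)) h6
  have hsum := add_mem_separableCone (add_mem_separableCone (add_mem_separableCone
    (add_mem_separableCone (add_mem_separableCone p1 p2) p3) p4) p5) p6
  convert hsum using 1
  rw [mul_diagonal_mul_conjTranspose_eq_sum]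
  simp only [Fintype.sum_prod_type, Fin.sum_univ_two]
  rw [e1, e2, e3, e4]
  module

open scoped MatrixOrder Matrix.Norms.L2Operator in
theorem exists_eq_conjTranspose_mul_self {n : Type} [Fintype n] [DecidableEq n]
    {A : Matrix n n ℂ} (hA : A.PosSemidef) : ∃ B : Matrix n n ℂ, A = Bᴴ * B :=
  CStarAlgebra.nonneg_iff_eq_star_mul_self.mp hA.nonneg

/-- Wootters decomposition of a positive definite two-qubit matrix. -/
theorem exists_wootters_decomposition {ρ : Matrix (Fin 2 × Fin 2) (Fin 2 × Fin 2) ℂ}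
    (hρ : ρ.PosDef) :
    ∃ F : Matrix (Fin 2 × Fin 2) (Fin 2 × Fin 2) ℂ, Fᵀ * spinFlip * F = 1 ∧
      ∃ σ : Fin 2 × Fin 2 → ℝ, (∀ i, 0 < σ i) ∧
        ρ = F * Matrix.diagonal (fun i => (σ i : ℂ)) * Fᴴ := by
  obtain ⟨B, hB⟩ := exists_eq_conjTranspose_mul_self hρ.posSemidef
  have hdet : B.det ≠ 0 := by
    intro h0
    have := hρ.det_pos
    rw [hB, Matrix.det_mul, h0, mul_zero] at this
    exact lt_irrefl _ this
  -- With ρ = B†B, Takagi diagonalizes the spin flip form pulled back along B†. Rescaling the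
  -- columns of B†U by σ^(-1/2) makes them orthonormal for that form.
  obtain ⟨U, hU, σ, hσ, hUσ⟩ := exists_unitary_transpose_mul_mul_eq_diagonal
    (τ := Bᴴᵀ * spinFlip * Bᴴ)
    (by rw [Matrix.transpose_mul, Matrix.transpose_mul, Matrix.transpose_transpose,
      spinFlip_transpose, mul_assoc])
    (by rw [Matrix.det_mul, Matrix.det_mul, spinFlip_det, Matrix.det_transpose,
          Matrix.det_conjTranspose, mul_one]
        exact mul_ne_zero (star_ne_zero.2 hdet) (star_ne_zero.2 hdet))
  have hUU : U * Uᴴ = 1 := Matrix.mem_unitaryGroup_iff.1 hU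
  have hsq : ∀ i, (Real.sqrt (σ i) : ℂ) * Real.sqrt (σ i) = σ i := fun i => by
    rw [← Complex.ofReal_mul, Real.mul_self_sqrt (hσ i).le]
  have hne : ∀ i, (Real.sqrt (σ i) : ℂ) ≠ 0 := fun i =>
    Complex.ofReal_ne_zero.2 (Real.sqrt_pos.2 (hσ i)).ne'
  set D : Matrix (Fin 2 × Fin 2) (Fin 2 × Fin 2) ℂ :=
    Matrix.diagonal (fun i => ((Real.sqrt (σ i) : ℂ))⁻¹) with hD
  have hDt : Dᵀ = D := Matrix.diagonal_transpose _
  have hDc : Dᴴ = D := by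
    rw [hD, Matrix.diagonal_conjTranspose]
    congr 1; ext i; simp
  refine ⟨Bᴴ * U * D, ?_, σ, hσ, ?_⟩
  · calc (Bᴴ * U * D)ᵀ * spinFlip * (Bᴴ * U * D)
        = D * (Uᵀ * (Bᴴᵀ * spinFlip * Bᴴ) * U) * D := by
          rw [Matrix.transpose_mul, Matrix.transpose_mul, hDt]
          simp only [mul_assoc]
      _ = 1 := by
          rw [hUσ, hD, Matrix.diagonal_mul_diagonal, Matrix.diagonal_mul_diagonal,
            ← Matrix.diagonal_one]
          congr 1; ext i
          rw [← hsq]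
          field_simp [hne i]
  · have hDD : D * Matrix.diagonal (fun i => (σ i : ℂ)) * D = 1 := by
      rw [hD, Matrix.diagonal_mul_diagonal, Matrix.diagonal_mul_diagonal, ← Matrix.diagonal_one]
      congr 1; ext i
      rw [← hsq]
      field_simp [hne i]
    calc ρ = Bᴴ * (U * Uᴴ) * B := by rw [hUU, mul_one, hB]
      _ = Bᴴ * U * (D * Matrix.diagonal (fun i => (σ i : ℂ)) * D) * Uᴴ * B := by
          rw [hDD, mul_one]
          simp only [mul_assoc]
      _ = _ := by
          rw [Matrix.conjTranspose_mul, Matrix.conjTranspose_mul, hDc,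
            Matrix.conjTranspose_conjTranspose]
          simp only [mul_assoc]

/-! ### Absolute separability of the tilted states -/

theorem trace_tiltedState {ψ φ : Fin 2 × Fin 2 → ℂ} (hψ : star ψ ⬝ᵥ ψ = 1)
    (hφ : star φ ⬝ᵥ φ = 1) : (tiltedState ψ φ).trace = 1 := by
  rw [tiltedState, Matrix.trace_add, Matrix.trace_smul, Matrix.trace_smul, Matrix.trace_sub,
    Matrix.trace_vecMulVec, Matrix.trace_vecMulVec, dotProduct_comm, hψ, dotProduct_comm, hφ,
    Matrix.trace_one]
  simp

theorem posDef_tiltedState {ψ φ : Fin 2 × Fin 2 → ℂ} (hφ : star φ ⬝ᵥ φ = 1) :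
    (tiltedState ψ φ).PosDef := by
  have hs := Real.sq_sqrt (show (0 : ℝ) ≤ 2 by norm_num)
  have hs1 : 1 ≤ Real.sqrt 2 := Real.one_le_sqrt.2 (by norm_num)
  have hs2 : Real.sqrt 2 < 3 / 2 := by nlinarith
  have hproj : (1 - Matrix.vecMulVec φ (star φ)).PosSemidef := by
    have hidem : Matrix.vecMulVec φ (star φ) * Matrix.vecMulVec φ (star φ) =
        Matrix.vecMulVec φ (star φ) := by
      rw [Matrix.vecMulVec_mul_vecMulVec, hφ, one_smul]
    have hherm : (Matrix.vecMulVec φ (star φ))ᴴ = Matrix.vecMulVec φ (star φ) :=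
      (posSemidef_vecMulVec_star φ).isHermitian
    have h := Matrix.posSemidef_conjTranspose_mul_self (1 - Matrix.vecMulVec φ (star φ))
    rwa [Matrix.conjTranspose_sub, Matrix.conjTranspose_one, hherm, mul_sub, sub_mul, sub_mul,
      hidem, one_mul, one_mul, mul_one, sub_self, sub_zero] at h
  -- The state is (1/4 - t)·1 + t(1 - |φ⟩⟨φ|) + t|ψ⟩⟨ψ| with t = (√2 - 1)/2 < 1/4.
  have h1 : ((1 / 4 - (Real.sqrt 2 - 1) / 2 : ℝ) •
      (1 : Matrix (Fin 2 × Fin 2) (Fin 2 × Fin 2) ℂ)).PosDef :=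
    Matrix.PosDef.one.smul (by linarith)
  have h2 := (h1.add_posSemidef (hproj.smul (show 0 ≤ (Real.sqrt 2 - 1) / 2 by linarith))).add_posSemidef
    ((posSemidef_vecMulVec_star ψ).smul (show 0 ≤ (Real.sqrt 2 - 1) / 2 by linarith))
  convert h2 using 1
  rw [tiltedState]
  module

theorem tiltedState_mem_separableStates {ψ φ : Fin 2 × Fin 2 → ℂ} (hψ : star ψ ⬝ᵥ ψ = 1)
    (hφ : star φ ⬝ᵥ φ = 1) : tiltedState ψ φ ∈ separableStates 2 := by
  refine mem_separableStates_of_mem_separableCone ?_ (trace_tiltedState hψ hφ)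
  obtain ⟨F, hF, σ, hσ, h⟩ := exists_wootters_decomposition (posDef_tiltedState (ψ := ψ) hφ)
  rw [h]
  refine mul_diagonal_mul_mem_separableCone hF (fun i => (hσ i).le) fun k => ?_
  set R := Fᵀ * spinFlip with hR
  have hRF : R * F = 1 := hF
  have hRR : Rᵀ * R = spinFlip := by
    have h1 : F * R = 1 := mul_eq_one_comm.1 hRF
    rw [hR, Matrix.transpose_mul, Matrix.transpose_transpose, spinFlip_transpose, ← hR,
      mul_assoc, h1, mul_one]
  have hpos := expectation_lorentzForm_tiltedState_nonneg hRR k hψ hφ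
  have hFR : Fᴴ * Rᴴ = 1 := by rw [← Matrix.conjTranspose_mul, hRF, Matrix.conjTranspose_one]
  -- Since R inverts F, the form built from R reads off the signed sum of the weights σ.
  have htr : (lorentzForm k R * tiltedState ψ φ).trace =
      ((∑ i, lorentzSign k i * σ i : ℝ) : ℂ) := by
    rw [h, lorentzForm]
    calc (Rᴴ * Matrix.diagonal (fun i => (lorentzSign k i : ℂ)) * R *
          (F * Matrix.diagonal (fun i => (σ i : ℂ)) * Fᴴ)).trace
        = (Rᴴ * (Matrix.diagonal (fun i => (lorentzSign k i : ℂ)) * (R * F) *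
            Matrix.diagonal (fun i => (σ i : ℂ))) * Fᴴ).trace := by simp only [mul_assoc]
      _ = _ := by
        rw [hRF, mul_one, Matrix.trace_mul_cycle, hFR, one_mul, Matrix.diagonal_mul_diagonal,
          Matrix.trace_diagonal]
        push_cast
        rfl
  rwa [expectation, Matrix.trace_mul_comm, htr, Complex.ofReal_re] at hpos

theorem tiltedState_mem_absSeparableStates {ψ φ : Fin 2 × Fin 2 → ℂ} (hψ : star ψ ⬝ᵥ ψ = 1)
    (hφ : star φ ⬝ᵥ φ = 1) : tiltedState ψ φ ∈ absSeparableStates 2 := by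
  refine ⟨separableStates_subset_quantumStates 2 (tiltedState_mem_separableStates hψ hφ),
    fun U hU => ?_⟩
  have hUU : U * Uᴴ = 1 := Matrix.mem_unitaryGroup_iff.1 hU
  have hUU' : Uᴴ * U = 1 := Matrix.mem_unitaryGroup_iff'.1 hU
  have hunit : ∀ x : Fin 2 × Fin 2 → ℂ, star x ⬝ᵥ x = 1 → star (U *ᵥ x) ⬝ᵥ (U *ᵥ x) = 1 := by
    intro x hx
    rw [Matrix.star_mulVec, ← Matrix.dotProduct_mulVec, Matrix.mulVec_mulVec, hUU',
      Matrix.one_mulVec, hx]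
  have hvec : ∀ x : Fin 2 × Fin 2 → ℂ, U * Matrix.vecMulVec x (star x) * Uᴴ =
      Matrix.vecMulVec (U *ᵥ x) (star (U *ᵥ x)) := by
    intro x
    rw [Matrix.mul_vecMulVec, Matrix.vecMulVec_mul, Matrix.star_mulVec]
  have : U * tiltedState ψ φ * Uᴴ = tiltedState (U *ᵥ ψ) (U *ᵥ φ) := by
    rw [tiltedState, tiltedState, ← hvec, ← hvec, mul_add, add_mul, mul_smul_comm, smul_mul_assoc,
      mul_smul_comm, smul_mul_assoc, mul_one, hUU, mul_sub, sub_mul]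
  rw [this]
  exact tiltedState_mem_separableStates (hunit ψ hψ) (hunit φ hφ)

/-! ### Numerical ranges of one observable and the lower bound -/

theorem volRange_single {ι : Type} [Fintype ι] (X : Set (Matrix ι ι ℂ)) (A : Matrix ι ι ℂ) :
    volRange X ![A] = (volume (expectation A '' X)).toReal := by
  have h : numericalRange X ![A] =
      MeasurableEquiv.funUnique (Fin 1) ℝ ⁻¹' (expectation A '' X) := by
    ext f
    constructor
    · rintro ⟨ρ, hρ, rfl⟩
      exact ⟨ρ, hρ, rfl⟩
    · rintro ⟨ρ, hρ, h⟩
      refine ⟨ρ, hρ, ?_⟩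
      ext j
      obtain rfl := Subsingleton.elim 0 j
      exact h
  rw [volRange, h]
  exact congrArg ENNReal.toReal
    ((volume_preserving_funUnique (Fin 1) ℝ).measure_preimage_equiv (expectation A '' X))

theorem isLinearMap_expectation {ι : Type} [Fintype ι] (A : Matrix ι ι ℂ) :
    IsLinearMap ℝ (expectation A) where
  map_add ρ σ := by simp [expectation, add_mul]
  map_smul c ρ := by simp [expectation]

/-- The numerical range of a Hermitian observable is the interval spanned by its extreme
eigenvalues, and pure states reach the endpoints. -/
theorem exists_expectation_image_eq_Icc {ι : Type} [Fintype ι] [DecidableEq ι] [Nonempty ι]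
    {A : Matrix ι ι ℂ} (hA : A.IsHermitian) :
    ∃ i j, (∀ k, hA.eigenvalues k ∈ Set.Icc (hA.eigenvalues j) (hA.eigenvalues i)) ∧
      (∃ ψ, star ψ ⬝ᵥ ψ = 1 ∧
        expectation A (Matrix.vecMulVec ψ (star ψ)) = hA.eigenvalues i) ∧
      (∃ φ, star φ ⬝ᵥ φ = 1 ∧
        expectation A (Matrix.vecMulVec φ (star φ)) = hA.eigenvalues j) ∧
      expectation A '' quantumStates ι = Set.Icc (hA.eigenvalues j) (hA.eigenvalues i) := by
  obtain ⟨i, hi⟩ := Finite.exists_max hA.eigenvalues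
  obtain ⟨j, hj⟩ := Finite.exists_min hA.eigenvalues
  have hex : ∀ k, ∃ ψ, star ψ ⬝ᵥ ψ = 1 ∧
      expectation A (Matrix.vecMulVec ψ (star ψ)) = hA.eigenvalues k := by
    intro k
    have hunit : star (hA.eigenvectorBasis k).ofLp ⬝ᵥ (hA.eigenvectorBasis k).ofLp = 1 := by
      have := orthonormal_iff_ite.1 hA.eigenvectorBasis.orthonormal k k
      rw [if_pos rfl, EuclideanSpace.inner_eq_star_dotProduct, dotProduct_comm] at this
      exact this
    refine ⟨(hA.eigenvectorBasis k).ofLp, hunit, ?_⟩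
    rw [expectation, Matrix.trace_mul_comm, Matrix.mul_vecMulVec, Matrix.trace_vecMulVec,
      hA.mulVec_eigenvectorBasis, smul_dotProduct, dotProduct_comm, hunit]
    simp
  refine ⟨i, j, fun k => ⟨hj k, hi k⟩, hex i, hex j, ?_⟩
  obtain ⟨ψ, hψ, hψ'⟩ := hex i
  obtain ⟨φ, hφ, hφ'⟩ := hex j
  apply Set.Subset.antisymm
  · rintro _ ⟨ρ, hρ, rfl⟩
    exact ⟨le_expectation hA hj hρ, expectation_le hA hi hρ⟩
  · have hc : Convex ℝ (expectation A '' quantumStates ι) :=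
      (convex_quantumStates ι).is_linear_image (isLinearMap_expectation A)
    exact hc.ordConnected.out ⟨_, vecMulVec_mem_quantumStates hφ, hφ'⟩
      ⟨_, vecMulVec_mem_quantumStates hψ, hψ'⟩

theorem exists_absSeparableStates_expectation_sub {A : Matrix (Fin 2 × Fin 2) (Fin 2 × Fin 2) ℂ}
    (hA : A.IsHermitian) : ∃ ρ ∈ absSeparableStates 2, ∃ σ ∈ absSeparableStates 2,
      (Real.sqrt 2 - 1) * volRange (quantumStates (Fin 2 × Fin 2)) ![A] =
        expectation A ρ - expectation A σ := by
  obtain ⟨i, j, hk, ⟨ψ, hψ, hψ'⟩, ⟨φ, hφ, hφ'⟩, hI⟩ := exists_expectation_image_eq_Icc hA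
  refine ⟨_, tiltedState_mem_absSeparableStates hψ hφ, _,
    tiltedState_mem_absSeparableStates hφ hψ, ?_⟩
  rw [volRange_single, hI, Real.volume_Icc, ENNReal.toReal_ofReal (sub_nonneg.2 (hk i).1),
    expectation_tiltedState, expectation_tiltedState, hψ', hφ']
  ring

/-- Convexity fills the interval between the expectations of the two tilted states. A general X
serves the separable and the absolutely separable states alike. -/
theorem mul_volRange_le_volRange {X : Set (Matrix (Fin 2 × Fin 2) (Fin 2 × Fin 2) ℂ)}
    (hX : Convex ℝ X) (h1 : absSeparableStates 2 ⊆ X) (h2 : X ⊆ quantumStates (Fin 2 × Fin 2))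
    {A : Matrix (Fin 2 × Fin 2) (Fin 2 × Fin 2) ℂ} (hA : A.IsHermitian) :
    (Real.sqrt 2 - 1) * volRange (quantumStates (Fin 2 × Fin 2)) ![A] ≤ volRange X ![A] := by
  obtain ⟨ρ, hρ, σ, hσ, h⟩ := exists_absSeparableStates_expectation_sub hA
  obtain ⟨i, j, -, -, -, hI⟩ := exists_expectation_image_eq_Icc hA
  have hc : Convex ℝ (expectation A '' X) := hX.is_linear_image (isLinearMap_expectation A)
  have hsub : Set.Icc (expectation A σ) (expectation A ρ) ⊆ expectation A '' X :=
    hc.ordConnected.out ⟨σ, h1 hσ, rfl⟩ ⟨ρ, h1 hρ, rfl⟩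
  -- Finiteness matters because `ENNReal.toReal` sends `⊤` to 0.
  have hfin : volume (expectation A '' X) ≠ ⊤ := by
    refine measure_ne_top_of_subset (Set.image_mono h2) ?_
    rw [hI, Real.volume_Icc]
    exact ENNReal.ofReal_ne_top
  have hm := ENNReal.toReal_mono hfin (measure_mono hsub)
  rw [h, volRange_single]
  rw [Real.volume_Icc] at hm
  exact (le_max_left _ _).trans (ENNReal.toReal_ofReal' ▸ hm)

/-- Zero length would make all eigenvalues equal, so the observable would be scalar and its
traceless part zero. -/
theorem volRange_quantumStates_pos {ι : Type} [Fintype ι] [DecidableEq ι] [Nonempty ι]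
    {A : Fin 1 → Matrix ι ι ℂ} (hA : IndependentObservables A) :
    0 < volRange (quantumStates ι) A := by
  obtain ⟨hH, hL⟩ := hA
  obtain ⟨i, j, hk, -, -, hI⟩ := exists_expectation_image_eq_Icc (hH 0)
  have hA0 : A = ![A 0] := by
    ext k; obtain rfl := Subsingleton.elim 0 k; rfl
  rw [hA0, volRange_single, hI, Real.volume_Icc, ENNReal.toReal_ofReal (sub_nonneg.2 (hk i).1),
    sub_pos]
  refine lt_of_le_of_ne (hk i).1 fun hij => hL.ne_zero 0 ?_
  have hconst : (fun k => (((hH 0).eigenvalues k : ℝ) : ℂ)) =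
      fun _ => (((hH 0).eigenvalues i : ℝ) : ℂ) := by
    ext k
    rw [le_antisymm (hk k).2 (hij ▸ (hk k).1)]
  have hs : A 0 = (((hH 0).eigenvalues i : ℝ) : ℂ) • (1 : Matrix ι ι ℂ) := by
    have hVV : ((hH 0).eigenvectorUnitary : Matrix ι ι ℂ) *
        ((hH 0).eigenvectorUnitary : Matrix ι ι ℂ)ᴴ = 1 :=
      Unitary.coe_mul_star_self (hH 0).eigenvectorUnitary
    have hspec : A 0 = ((hH 0).eigenvectorUnitary : Matrix ι ι ℂ) *
        Matrix.diagonal (fun k => ((hH 0).eigenvalues k : ℂ)) *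
        ((hH 0).eigenvectorUnitary : Matrix ι ι ℂ)ᴴ := by
      conv_lhs => rw [(hH 0).spectral_theorem]
      rfl
    rw [hconst, ← Matrix.smul_one_eq_diagonal, mul_smul_comm, mul_one, smul_mul_assoc, hVV] at hspec
    exact hspec
  have hcard : (Fintype.card ι : ℂ) ≠ 0 := Nat.cast_ne_zero.2 Fintype.card_ne_zero
  generalize (((hH 0).eigenvalues i : ℝ) : ℂ) = c at hs
  rw [hs, Matrix.trace_smul, Matrix.trace_one, smul_eq_mul, mul_div_cancel_right₀ _ hcard, sub_self]

theorem le_volRatio {X : Set (Matrix (Fin 2 × Fin 2) (Fin 2 × Fin 2) ℂ)}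
    (hX : Convex ℝ X) (h1 : absSeparableStates 2 ⊆ X) (h2 : X ⊆ quantumStates (Fin 2 × Fin 2))
    {r : ℝ} (hr : r ∈ volRatios 1 X) : Real.sqrt 2 - 1 ≤ r := by
  obtain ⟨A, hA, rfl⟩ := hr
  have hA0 : A = ![A 0] := by
    ext k; obtain rfl := Subsingleton.elim 0 k; rfl
  rw [volRatio, le_div_iff₀ (volRange_quantumStates_pos hA), hA0]
  exact mul_volRange_le_volRange hX h1 h2 (hA.1 0)

/-! ### Upper bound for absolutely separable states -/

/-- Product states have nonnegative expectation in the partial transpose of a pure state. -/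
theorem witness_nonneg {τ : Matrix (Fin 2 × Fin 2) (Fin 2 × Fin 2) ℂ}
    (hτ : τ ∈ separableStates 2) (c s : ℝ) :
    0 ≤ c ^ 2 * (τ (0, 0) (0, 0)).re + s ^ 2 * (τ (1, 1) (1, 1)).re +
      2 * (c * s) * (τ (0, 1) (1, 0)).re := by
  have hlin : IsLinearMap ℝ fun τ : Matrix (Fin 2 × Fin 2) (Fin 2 × Fin 2) ℂ =>
      c ^ 2 * (τ (0, 0) (0, 0)).re + s ^ 2 * (τ (1, 1) (1, 1)).re +
        2 * (c * s) * (τ (0, 1) (1, 0)).re :=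
    { map_add := fun x y => by simp only [Matrix.add_apply, Complex.add_re]; ring
      map_smul := fun a x => by
        simp only [Matrix.smul_apply, Complex.smul_re, smul_eq_mul]; ring }
  refine convexHull_min ?_ (convex_halfSpace_ge hlin 0) hτ
  rintro _ ⟨α, hα, β, hβ, rfl⟩
  -- Transposing the second factor keeps a product state positive; it is tested on c|00⟩ + s|11⟩.
  have h := (hα.1.kronecker hβ.1.transpose).re_dotProduct_nonneg
    fun p : Fin 2 × Fin 2 => if p = (0, 0) then (c : ℂ) else if p = (1, 1) then (s : ℂ) else 0
  have e1 : α 1 0 = star (α 0 1) := (hα.1.isHermitian.apply 1 0).symm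
  have e2 : β 0 1 = star (β 1 0) := (hβ.1.isHermitian.apply 0 1).symm
  simp [dotProduct, Matrix.mulVec, Fintype.sum_prod_type, Fin.sum_univ_two, e1, e2] at h
  simp [Matrix.kroneckerMap_apply]
  nlinarith [h]

theorem submatrix_mem_absSeparableStates {ρ : Matrix (Fin 2 × Fin 2) (Fin 2 × Fin 2) ℂ}
    (hρ : ρ ∈ absSeparableStates 2) (e : Equiv.Perm (Fin 2 × Fin 2)) :
    ρ.submatrix e e ∈ absSeparableStates 2 := by
  have hU : (1 : Matrix (Fin 2 × Fin 2) (Fin 2 × Fin 2) ℂ).submatrix e id ∈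
      Matrix.unitaryGroup (Fin 2 × Fin 2) ℂ := by
    rw [Matrix.mem_unitaryGroup_iff]
    ext i j
    simp [Matrix.mul_apply, Matrix.one_apply, apply_ite, eq_comm]
  convert conj_mem_absSeparableStates hρ hU using 1
  ext i j
  simp [Matrix.mul_apply, Matrix.one_apply, apply_ite]

/-- The unitary that maps the product basis to the basis of two product vectors and two Bell
vectors. -/
noncomputable def bellUnitary : Matrix (Fin 2 × Fin 2) (Fin 2 × Fin 2) ℂ := fun p q =>
  if p.1 = p.2 then (if p = q then 1 else 0)
  else if q.1 = q.2 then 0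
  else if p = (1, 0) ∧ q = (1, 0) then -(Real.sqrt 2 / 2 : ℝ) else (Real.sqrt 2 / 2 : ℝ)

theorem bellUnitary_mem_unitaryGroup : bellUnitary ∈ Matrix.unitaryGroup (Fin 2 × Fin 2) ℂ := by
  have hs : (Real.sqrt 2 : ℂ) ^ 2 = 2 := by
    exact_mod_cast Real.sq_sqrt (show (0 : ℝ) ≤ 2 by norm_num)
  rw [Matrix.mem_unitaryGroup_iff]
  ext ⟨i, j⟩ ⟨k, l⟩
  fin_cases i <;> fin_cases j <;> fin_cases k <;> fin_cases l <;>
    simp [bellUnitary, Matrix.mul_apply, Fintype.sum_prod_type, Fin.sum_univ_two,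
      Matrix.star_apply, map_ofNat] <;> linear_combination hs / 2

/-- In the Bell basis the real part of the coherence between (0,1) and (1,0) becomes half a
difference of populations. -/
theorem bell_witness_nonneg {ρ : Matrix (Fin 2 × Fin 2) (Fin 2 × Fin 2) ℂ}
    (hρ : ρ ∈ absSeparableStates 2) (c s : ℝ) :
    0 ≤ c ^ 2 * (ρ (0, 0) (0, 0)).re + s ^ 2 * (ρ (1, 1) (1, 1)).re +
      c * s * ((ρ (0, 1) (0, 1)).re - (ρ (1, 0) (1, 0)).re) := by
  have hs := Real.sq_sqrt (show (0 : ℝ) ≤ 2 by norm_num)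
  have h := witness_nonneg (hρ.2 _ bellUnitary_mem_unitaryGroup) c s
  have e1 : ρ (1, 0) (0, 1) = star (ρ (0, 1) (1, 0)) := (hρ.1.1.isHermitian.apply _ _).symm
  simp [bellUnitary, Matrix.mul_apply, Fintype.sum_prod_type, Fin.sum_univ_two,
      e1, -Complex.ofReal_div] at h
  linear_combination h + c * s / 2 * ((ρ (0, 1) (0, 1)).re - (ρ (1, 0) (1, 0)).re) * hs

theorem apply_sub_apply_le {ρ : Matrix (Fin 2 × Fin 2) (Fin 2 × Fin 2) ℂ}
    (hρ : ρ ∈ absSeparableStates 2) :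
    (ρ (1, 0) (1, 0)).re - (ρ (0, 0) (0, 0)).re ≤ Real.sqrt 2 - 1 := by
  have hs := Real.sq_sqrt (show (0 : ℝ) ≤ 2 by norm_num)
  have hs1 : 1 ≤ Real.sqrt 2 := Real.one_le_sqrt.2 (by norm_num)
  -- Adding the witness to its copy with (0,1) and (1,1) exchanged gives the two middle populations
  -- equal weight, so the trace eliminates them. The choice c = 1 + √2 then makes the coefficients
  -- of the remaining two opposite.
  have h1 := bell_witness_nonneg hρ (1 + Real.sqrt 2) 1
  have h2 := bell_witness_nonneg
    (submatrix_mem_absSeparableStates hρ (Equiv.swap (0, 1) (1, 1))) (1 + Real.sqrt 2) 1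
  have htr : (ρ (0, 0) (0, 0)).re + (ρ (0, 1) (0, 1)).re + (ρ (1, 0) (1, 0)).re +
      (ρ (1, 1) (1, 1)).re = 1 := by
    have := congrArg Complex.re hρ.1.2
    simp [Matrix.trace, Fintype.sum_prod_type, Fin.sum_univ_two] at this
    linarith
  have s1 : Equiv.swap ((0 : Fin 2), (1 : Fin 2)) (1, 1) (0, 0) = (0, 0) := by decide
  have s2 : Equiv.swap ((0 : Fin 2), (1 : Fin 2)) (1, 1) (1, 0) = (1, 0) := by decide
  simp only [Matrix.submatrix_apply, s1, s2, Equiv.swap_apply_left, Equiv.swap_apply_right] at h2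
  generalize (ρ (0, 0) (0, 0)).re = d at *
  generalize (ρ (0, 1) (0, 1)).re = c at *
  generalize (ρ (1, 0) (1, 0)).re = a at *
  generalize (ρ (1, 1) (1, 1)).re = b at *
  have h3 : 0 ≤ (2 + Real.sqrt 2) * 1 + (4 + 3 * Real.sqrt 2) * (d - a) := by
    rw [← htr]
    linear_combination h1 + h2 + 2 * d * hs
  -- The factor 3√2 - 4 clears the coefficient, as (3√2 - 4)(3√2 + 4) = 2.
  have h4 : 0 ≤ (3 * Real.sqrt 2 - 4) * ((2 + Real.sqrt 2) * 1 + (4 + 3 * Real.sqrt 2) * (d - a)) :=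
    mul_nonneg (by nlinarith) h3
  linear_combination h4 / 2 + (3 / 2 + 9 / 2 * (d - a)) * hs

theorem abs_apply_sub_apply_le {ρ : Matrix (Fin 2 × Fin 2) (Fin 2 × Fin 2) ℂ}
    (hρ : ρ ∈ absSeparableStates 2) :
    |(ρ (0, 0) (0, 0)).re - (ρ (1, 1) (1, 1)).re| ≤ Real.sqrt 2 - 1 := by
  have h1 := apply_sub_apply_le
    (submatrix_mem_absSeparableStates hρ (Equiv.swap (1, 0) (1, 1)))
  have h2 := apply_sub_apply_le (submatrix_mem_absSeparableStates hρ
    ((Equiv.swap (1, 0) (1, 1)).trans (Equiv.swap (0, 0) (1, 1))))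
  have s1 : Equiv.swap ((1 : Fin 2), (0 : Fin 2)) (1, 1) (0, 0) = (0, 0) := by decide
  simp only [Matrix.submatrix_apply, Equiv.trans_apply, s1, Equiv.swap_apply_left,
    Equiv.swap_apply_right] at h1 h2
  exact abs_sub_le_iff.2 ⟨h2, h1⟩

/-! ### Observables with spectrum (1, 1/2, 1/2, 0) -/

/-- The diagonal observable with eigenvalues `1, 1/2, 1/2, 0`. -/
noncomputable def extremalObservable : Matrix (Fin 2 × Fin 2) (Fin 2 × Fin 2) ℂ :=
  Matrix.diagonal fun p => if p = (0, 0) then 1 else if p = (1, 1) then 0 else 1 / 2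

theorem isHermitian_extremalObservable : extremalObservable.IsHermitian := by
  rw [extremalObservable, Matrix.isHermitian_diagonal_iff]
  rintro ⟨i, j⟩
  fin_cases i <;> fin_cases j <;> simp [isSelfAdjoint_iff]

theorem roots_charpoly_extremalObservable :
    extremalObservable.charpoly.roots = {1, 1 / 2, 1 / 2, 0} := by
  rw [extremalObservable, Matrix.charpoly_diagonal, Polynomial.roots_prod _ _
    (Finset.prod_ne_zero_iff.2 fun _ _ => Polynomial.X_sub_C_ne_zero _)]
  have : (Finset.univ : Finset (Fin 2 × Fin 2)).val = {(0, 0), (0, 1), (1, 0), (1, 1)} := by decide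
  simp [this, Polynomial.roots_X_sub_C]

theorem independentObservables_extremalObservable :
    IndependentObservables ![extremalObservable] := by
  refine ⟨fun j => ?_, ?_⟩
  · obtain rfl := Subsingleton.elim 0 j
    exact isHermitian_extremalObservable
  · rw [linearIndependent_unique_iff]
    intro h
    have h1 := congrFun (congrFun h (0, 0)) (0, 0)
    have h2 := congrFun (congrFun h (1, 1)) (1, 1)
    simp [extremalObservable] at h1 h2
    rw [h2] at h1
    simp at h1

/-- Hermitian matrices with the same characteristic polynomial are unitarily equivalent. -/
theorem exists_unitary_conj_of_charpoly_eq {n : Type} [Fintype n] [DecidableEq n]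
    {A B : Matrix n n ℂ} (hA : A.IsHermitian) (hB : B.IsHermitian)
    (h : A.charpoly = B.charpoly) : ∃ U ∈ Matrix.unitaryGroup n ℂ, A = U * B * Uᴴ := by
  have he := (hA.eigenvalues_eq_eigenvalues_iff hB).2 h
  set V : Matrix n n ℂ := (hA.eigenvectorUnitary : Matrix n n ℂ)
  set W : Matrix n n ℂ := (hB.eigenvectorUnitary : Matrix n n ℂ)
  have hW : Wᴴ * W = 1 := Unitary.coe_star_mul_self hB.eigenvectorUnitary
  have hAs : A = V * Matrix.diagonal (fun i => (hA.eigenvalues i : ℂ)) * Vᴴ := by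
    conv_lhs => rw [hA.spectral_theorem]
    rfl
  have hBs : B = W * Matrix.diagonal (fun i => (hB.eigenvalues i : ℂ)) * Wᴴ := by
    conv_lhs => rw [hB.spectral_theorem]
    rfl
  rw [he] at hAs
  refine ⟨V * Wᴴ, (hA.eigenvectorUnitary * star hB.eigenvectorUnitary).2, ?_⟩
  generalize hB.eigenvalues = μ at hAs hBs
  rw [Matrix.conjTranspose_mul, Matrix.conjTranspose_conjTranspose]
  calc A = V * (Wᴴ * W) * Matrix.diagonal (fun i => (μ i : ℂ)) * (Wᴴ * W) * Vᴴ := by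
        rw [hW, mul_one, mul_one, hAs]
    _ = V * Wᴴ * (W * Matrix.diagonal (fun i => (μ i : ℂ)) * Wᴴ) * (W * Vᴴ) := by
        simp only [mul_assoc]
    _ = V * Wᴴ * B * (W * Vᴴ) := by rw [← hBs]

theorem expectation_extremalObservable {ρ : Matrix (Fin 2 × Fin 2) (Fin 2 × Fin 2) ℂ}
    (hρ : ρ ∈ quantumStates (Fin 2 × Fin 2)) :
    expectation extremalObservable ρ =
      1 / 2 + ((ρ (0, 0) (0, 0)).re - (ρ (1, 1) (1, 1)).re) / 2 := by
  have htr := congrArg Complex.re hρ.2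
  simp [Matrix.trace, Fintype.sum_prod_type, Fin.sum_univ_two] at htr
  simp [expectation, extremalObservable, Matrix.trace, Matrix.mul_diagonal,
    Fintype.sum_prod_type, Fin.sum_univ_two]
  linarith

theorem volRatio_absSeparableStates_of_roots {A : Matrix (Fin 2 × Fin 2) (Fin 2 × Fin 2) ℂ}
    (hA : A.IsHermitian) (hroots : A.charpoly.roots = {1, 1 / 2, 1 / 2, 0}) :
    volRatio (absSeparableStates 2) ![A] = Real.sqrt 2 - 1 := by
  have hs1 : 1 < Real.sqrt 2 := Real.lt_sqrt_of_sq_lt (by norm_num)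
  have hQ : 1 ≤ volRange (quantumStates (Fin 2 × Fin 2)) ![A] := by
    obtain ⟨i, j, hk, -, -, hI⟩ := exists_expectation_image_eq_Icc hA
    have hmem : ∀ r : ℝ, (r : ℂ) ∈ A.charpoly.roots → ∃ k, hA.eigenvalues k = r := by
      intro r hr
      rw [hA.roots_charpoly_eq_eigenvalues, Multiset.mem_map] at hr
      obtain ⟨k, -, hk⟩ := hr
      exact ⟨k, Complex.ofReal_injective hk⟩
    obtain ⟨a, ha⟩ := hmem 1 (by rw [hroots]; simp)
    obtain ⟨b, hb⟩ := hmem 0 (by rw [hroots]; simp)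
    rw [volRange_single, hI, Real.volume_Icc, ENNReal.toReal_ofReal (sub_nonneg.2 (hk i).1)]
    linarith [(hk a).2, (hk b).1]
  have hlow := mul_volRange_le_volRange (convex_absSeparableStates 2) subset_rfl
    ((absSeparableStates_subset_separableStates 2).trans
      (separableStates_subset_quantumStates 2)) hA
  have hup : volRange (absSeparableStates 2) ![A] ≤ Real.sqrt 2 - 1 := by
    -- Both characteristic polynomials are monic and split, so equal roots make them equal; the
    -- observables are then unitarily conjugate, and the conjugation can be moved onto the state.
    have hchar : A.charpoly = extremalObservable.charpoly := by
      rw [hA.splits_charpoly.eq_prod_roots_of_monic A.charpoly_monic,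
        isHermitian_extremalObservable.splits_charpoly.eq_prod_roots_of_monic
          extremalObservable.charpoly_monic, hroots, roots_charpoly_extremalObservable]
    obtain ⟨U, hU, hAU⟩ :=
      exists_unitary_conj_of_charpoly_eq hA isHermitian_extremalObservable hchar
    have hsub : expectation A '' absSeparableStates 2 ⊆
        Set.Icc (1 / 2 - (Real.sqrt 2 - 1) / 2) (1 / 2 + (Real.sqrt 2 - 1) / 2) := by
      rintro _ ⟨ρ, hρ, rfl⟩
      have hρ' : Uᴴ * ρ * U ∈ absSeparableStates 2 := by
        have h := conj_mem_absSeparableStates hρ (Unitary.star_mem hU)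
        rwa [Matrix.star_eq_conjTranspose, Matrix.conjTranspose_conjTranspose] at h
      have heq : expectation A ρ = expectation extremalObservable (Uᴴ * ρ * U) := by
        rw [expectation, expectation, hAU, ← mul_assoc, Matrix.trace_mul_comm]
        simp only [mul_assoc]
      have h := abs_le.1 (abs_apply_sub_apply_le hρ')
      rw [heq, expectation_extremalObservable hρ'.1]
      exact ⟨by linarith [h.1], by linarith [h.2]⟩
    have hm := ENNReal.toReal_mono (by rw [Real.volume_Icc]; exact ENNReal.ofReal_ne_top)
      (measure_mono (μ := volume) hsub)
    rw [Real.volume_Icc, ENNReal.toReal_ofReal (by linarith)] at hm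
    rw [volRange_single]
    linarith
  -- The bounds `hlow` and `hup` together force the full range to have length at most 1.
  have hQ1 : volRange (quantumStates (Fin 2 × Fin 2)) ![A] = 1 := by nlinarith
  rw [volRatio, hQ1, div_one]
  rw [hQ1, mul_one] at hlow
  exact le_antisymm hup hlow

theorem proposition7 :
    -- the lower bound on the minimal volume ratio
    Real.sqrt 2 - 1 ≤ minVolRatio 2 1 ∧
    -- absolutely separable states already span this share of the range of any observable
    (∀ A : Matrix (Fin 2 × Fin 2) (Fin 2 × Fin 2) ℂ, A.IsHermitian →
      ∃ ρ ∈ absSeparableStates 2, ∃ σ ∈ absSeparableStates 2,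
        (Real.sqrt 2 - 1) * volRange (quantumStates (Fin 2 × Fin 2)) ![A] ≤
          expectation A ρ - expectation A σ) ∧
    -- it is the best bound that absolutely separable states can give
    IsLeast (volRatios 1 (absSeparableStates 2)) (Real.sqrt 2 - 1) ∧
    -- it is attained by the observables with spectrum (1, 1/2, 1/2, 0)
    (∀ A : Matrix (Fin 2 × Fin 2) (Fin 2 × Fin 2) ℂ, A.IsHermitian →
      A.charpoly.roots = {1, 1 / 2, 1 / 2, 0} →
        volRatio (absSeparableStates 2) ![A] = Real.sqrt 2 - 1) := by
  refine ⟨?_, ?_, ⟨?_, ?_⟩, ?_⟩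
  -- The extremal observable supplies the nonemptiness required to bound the infimum from below.
  · exact le_csInf ⟨_, _, independentObservables_extremalObservable, rfl⟩ fun r hr =>
      le_volRatio (convex_separableStates 2) (absSeparableStates_subset_separableStates 2)
        (separableStates_subset_quantumStates 2) hr
  · intro A hA
    obtain ⟨ρ, hρ, σ, hσ, h⟩ := exists_absSeparableStates_expectation_sub hA
    exact ⟨ρ, hρ, σ, hσ, h.le⟩
  · exact ⟨_, independentObservables_extremalObservable,
      (volRatio_absSeparableStates_of_roots isHermitian_extremalObservable
        roots_charpoly_extremalObservable).symm⟩
  · exact fun r hr => le_volRatio (convex_absSeparableStates 2) subset_rfl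
      ((absSeparableStates_subset_separableStates 2).trans
        (separableStates_subset_quantumStates 2)) hr
  · exact fun A hA h => volRatio_absSeparableStates_of_roots hA h
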